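/- **Model.** A finite directed network has nodes $N=\mathcal O\sqcup U$ (overlay and underlay) and links $(a,b)$ with integer capacities $c_{ab}\ge 1$ (packets per slot). A tunnel $l=(l_1,\dots,l_{|l|})$ is a path without repeated nodes whose two ends are overlay nodes and whose other nodes are underlay nodes; a direct link between overlay nodes is a tunnel without underlay nodes. Each commodity $k$ has a destination $d_k\in\mathcal O$ and may use a given set $L_k$ of tunnels ($L_k=L$, all tunnels, is allowed). If $F^k_l(t)$ packets of commodity $k$ are injected into tunnel $l$ in slot $t$ and $\bar F^k_l(t)$ exit it, then $Q^k_{d_k}=0$ and, for $n\neq d_k$, $$Q^k_n(t+1)=\Big[Q^k_n(t)-\sum_{l:\,l_1=n}F^k_l(t)+\sum_{l:\,l_{|l|}=n}\bar F^k_l(t)+A^k_n(t)\Big]^+ .$$ The initial backlogs have finite second moments. The arrival vectors $A(t)$ are i.i.d. over time with mean $\lambda$ and finite second moments, and $A(t)$ is independent of everything before slot $t$; all decisions are non-anticipating. Direct tunnels are crossed in the slot of injection. In the other tunnels packets wait in one queue for each link that leaves an underlay node; the underlay is initially empty and uses a work-conserving forwarding scheme that is *universally stable*: on every network, for every window $w\ge1$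 and rate $r<1$, the underlay queues are bounded by a constant depending only on the network, $w$ and $r$, whenever in any $w$ consecutive slots at most $r\,w\,c_{ab}$ packets are injected into the tunnels through each underlay link $(a,b)$ (a link with $a\in U$). A queue $Z$ is *strongly stable* if $\limsup_{t\to\infty}\frac1t\sum_{s<t}\mathbb E[Z(s)]<\infty$. The *stability region* $\Lambda$ is the closure of the set of mean vectors of arrival sequences for which some non-anticipating routing, respecting the capacity of the first link of each tunnel in every slot, makes all overlay and underlay queues strongly stable. A rate vector $\lambda$ is *inside* $\Lambda$ if for some $\varepsilon>0$ there is $\lambda'\in\Lambda$ with $\lambda'\ge\lambda$ and ${\lambda'}^k_n\ge\lambda^k_n+\varepsilon$ for all $k$ and all ends $n$ of tunnels in $L_k$. **Centralized policy** with frame length $T$, accuracy $\delta$ and period $q$. At the beginning $t$ of each frame take a solution $F^*$ of $$\max\ \sum_{k}\sum_{l\in L_k}F^k_l\,[Q^k_{l_1}(t)-Q^k_{l_{|l|}}(t)]\quad\text{s.t.}\quad \sum_{l\ni(a,b)}\sum_kF^k_l\le c_{ab}\ \text{ for all links }(a,b),\quad F^k_l\ge0,\quad F^k_l=0\ \text{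 if } l\notin L_k,$$ and integers $p^k_l\ge0$ with $|p^k_l/q-{F^k_l}^*|\le\delta$ such that the rates $p^k_l/q$ satisfy the same constraints, with strict inequality $\sum_{l\ni(a,b)}\sum_k p^k_l/q<c_{ab}$ on the underlay links. Schedule $p^k_l$ packets of commodity $k$ for tunnel $l$ in each successive block of $q$ slots of the frame (at most $p^k_l$ in an incomplete last block). Scheduled packets are sent; a node with too small a backlog may send fewer, but at least its whole backlog. **Theorem.** Let $\lambda$ be inside the stability region $\Lambda$. There is $\delta>0$ such that for every period $q\ge1$ there are constants $B$ and $T_0$ such that for every frame length $T\ge T_0$, under the centralized policy with parameters $T,\delta,q$ and arrival rate vector $\lambda$, all queues in the network are stable: every overlay queue $Q^k_n$ is strongly stable, and every underlay queue contains at most $B$ packets at all times. -/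

import Mathlib

open MeasureTheory ProbabilityTheory Filter
open scoped ENNReal

/-- A finite directed network with overlay nodes, underlay nodes, tunnels and commodities.
The directed links are the pairs of nodes with positive capacity (in packets per slot).
A tunnel is the node sequence `first, inner, last`: its two ends are overlay nodes, all its
other nodes are underlay nodes, consecutive nodes are joined by links, and no node is repeated.
A direct overlay-to-overlay link is a tunnel with empty `inner`.
`usable l k` says that commodity `k` may be sent into tunnel `l`; the network in which every
commodity may use every tunnel is the case where `usable` is always true. -/
structure OverlayNetwork where
  Overlay : Type
  Under : Type
  Tunnel : Type
  Commodity : Type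
  [fintypeOverlay : Fintype Overlay]
  [decEqOverlay : DecidableEq Overlay]
  [fintypeUnder : Fintype Under]
  [decEqUnder : DecidableEq Under]
  [fintypeTunnel : Fintype Tunnel]
  [decEqTunnel : DecidableEq Tunnel]
  [fintypeCommodity : Fintype Commodity]
  [decEqCommodity : DecidableEq Commodity]
  cap : Overlay ⊕ Under → Overlay ⊕ Under → ℕ
  first : Tunnel → Overlay
  inner : Tunnel → List Under
  last : Tunnel → Overlay
  first_ne_last : ∀ l, first l ≠ last l
  inner_nodup : ∀ l, (inner l).Nodup
  isChain : ∀ l, List.IsChain (fun a b => 0 < cap a b)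
    (Sum.inl (first l) :: ((inner l).map Sum.inr ++ [Sum.inl (last l)]))
  dest : Commodity → Overlay
  usable : Tunnel → Commodity → Prop

attribute [instance] OverlayNetwork.fintypeOverlay OverlayNetwork.decEqOverlay
  OverlayNetwork.fintypeUnder OverlayNetwork.decEqUnder
  OverlayNetwork.fintypeTunnel OverlayNetwork.decEqTunnel
  OverlayNetwork.fintypeCommodity OverlayNetwork.decEqCommodity

namespace OverlayNetwork

variable (N : OverlayNetwork)

/-- All nodes. -/
abbrev Node : Type := N.Overlay ⊕ N.Under

/-- The node sequence of a tunnel. -/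
def path (l : N.Tunnel) : List N.Node :=
  Sum.inl (N.first l) :: ((N.inner l).map Sum.inr ++ [Sum.inl (N.last l)])

/-- The links of a tunnel, in order. -/
def links (l : N.Tunnel) : List (N.Node × N.Node) :=
  (N.path l).zip (N.path l).tail

/-- The links of a tunnel that leave an underlay node, in order: all but the first one.
These are the links on whose queues the packets of the tunnel wait. -/
def route (l : N.Tunnel) : List (N.Node × N.Node) :=
  (N.links l).tail

/-- The tunnels that contain the link `(a, b)`. -/
def tunnelsThrough (a b : N.Node) : Finset N.Tunnel :=
  Finset.univ.filter (fun l => (a, b) ∈ (N.links l).toFinset)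

/-- Amounts sent into the tunnels in each slot: `X t l k` packets of commodity `k` enter
tunnel `l` in slot `t`. -/
abbrev Injection : Type := ℕ → N.Tunnel → N.Commodity → ℕ

/-- Packet number `i` among those of commodity `k` injected into tunnel `l` in slot `s` is
`⟨(s, l, k), i⟩`. -/
abbrev Packet : Type := Σ _ : ℕ × N.Tunnel × N.Commodity, ℕ

variable {N}

/-- The packets injected before slot `t`. -/
def injected (X : N.Injection) (t : ℕ) : Finset N.Packet :=
  (Finset.range t ×ˢ (Finset.univ : Finset (N.Tunnel × N.Commodity))).sigma
    (fun x => Finset.range (X x.1 x.2.1 x.2.2))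

/-- `serve t` is the set of packets forwarded by underlay nodes in slot `t`.  A packet has
completed `hops serve t p` underlay links by the beginning of slot `t`. -/
def hops (serve : ℕ → Finset N.Packet) (t : ℕ) (p : N.Packet) : ℕ :=
  ((Finset.range t).filter (fun s => p ∈ serve s)).card

/-- The underlay queue of link `e` at the beginning of slot `t`. -/
def queue (X : N.Injection) (serve : ℕ → Finset N.Packet) (t : ℕ) (e : N.Node × N.Node) :
    Finset N.Packet :=
  (injected X t).filter (fun p => (N.route p.1.2.1)[hops serve t p]? = some e)

/-- The number of packets of commodity `k` that exit tunnel `l` in slot `t`.  A tunnel without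
underlay nodes is crossed in the slot of injection. -/
def exits (X : N.Injection) (serve : ℕ → Finset N.Packet) (t : ℕ) (l : N.Tunnel)
    (k : N.Commodity) : ℕ :=
  if N.inner l = [] then X t l k
  else ((serve t).filter (fun p => p.1.2 = (l, k) ∧
    hops serve t p + 1 = (N.route l).length)).card

/-- The forwarding is work-conserving: in every slot only queued packets are forwarded, and the
queue of a link of capacity `c` forwards `c` packets, or all its packets if there are fewer. -/
def WorkConserving (X : N.Injection) (serve : ℕ → Finset N.Packet) : Prop :=
  ∀ t, (∀ p ∈ serve t, ∃ e, p ∈ queue X serve t e) ∧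
    ∀ e : N.Node × N.Node,
      (serve t ∩ queue X serve t e).card = min (N.cap e.1 e.2) (queue X serve t e).card

end OverlayNetwork

/-- A (possibly nondeterministic) forwarding rule, defined on every network: given the slot `t`,
the injections and the forwarded packets of the slots before `t`, it says which sets of packets
may be forwarded in slot `t`. -/
def ForwardingScheme : Type 1 :=
  ∀ N : OverlayNetwork, ℕ → N.Injection → (ℕ → Finset N.Packet) → Finset N.Packet → Prop

namespace OverlayNetwork

/-- `serve` is a work-conserving execution of the scheme `P` under the injections `X`.  The
scheme sees the past only. -/
def Executes {N : OverlayNetwork} (P : ForwardingScheme) (X : N.Injection)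
    (serve : ℕ → Finset N.Packet) : Prop :=
  WorkConserving X serve ∧
    ∀ t, P N t (fun s l k => if s < t then X s l k else 0)
      (fun s => if s < t then serve s else ∅) (serve t)

/-- A bounded adversary of window `w` and rate `r`: in any `w` consecutive slots the number of
injected packets whose tunnel contains a given underlay link of capacity `c` is at most
`r * w * c`. -/
def BoundedAdversary {N : OverlayNetwork} (w : ℕ) (r : ℝ) (X : N.Injection) : Prop :=
  ∀ (t : ℕ) (u : N.Under) (b : N.Node), 0 < N.cap (Sum.inr u) b →
    ((∑ s ∈ Finset.Ico t (t + w), ∑ l ∈ N.tunnelsThrough (Sum.inr u) b, ∑ k, X s l k : ℕ) : ℝ)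
      ≤ r * w * (N.cap (Sum.inr u) b : ℝ)

/-- Universal stability: on every network and against bounded adversaries of any window
and any rate below `1`, the underlay queues are bounded by a constant that depends only on the
network, the window and the rate. -/
def UniversallyStable (P : ForwardingScheme) : Prop :=
  ∀ (N : OverlayNetwork) (w : ℕ) (r : ℝ), 0 < w → r < 1 →
    ∃ B : ℕ, ∀ (X : N.Injection) (serve : ℕ → Finset N.Packet),
      Executes P X serve → BoundedAdversary w r X →
        ∀ (t : ℕ) (e : N.Node × N.Node), (queue X serve t e).card ≤ B

/-- Strong stability of a queue: `limsup (1/t) ∑_{s<t} E[Z s] < ∞`. -/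
def StronglyStable {Ω : Type*} [MeasurableSpace Ω] (μ : Measure Ω) (Z : ℕ → Ω → ℕ) : Prop :=
  limsup (fun t : ℕ => (∑ s ∈ Finset.range t, ∫⁻ ω, (Z s ω : ℝ≥0∞) ∂μ) / (t : ℝ≥0∞)) atTop < ⊤

variable (N : OverlayNetwork)

/-- External arrivals: the vectors `A t` are i.i.d. over time with mean `rate` and finite second
moments.  `A t` is known from time `t + 1` on and independent of the past `ℱ t`. -/
structure IsArrivalSequence {Ω : Type*} [mΩ : MeasurableSpace Ω] (μ : Measure Ω)
    (ℱ : Filtration ℕ mΩ) (rate : N.Overlay → N.Commodity → ℝ)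
    (A : ℕ → Ω → N.Overlay → N.Commodity → ℕ) : Prop where
  measurable : ∀ t, Measurable[ℱ (t + 1)] (A t)
  indep : ∀ t, Indep (MeasurableSpace.comap (A t) inferInstance) (ℱ t) μ
  identDistrib : ∀ t, IdentDistrib (A t) (A 0) μ μ
  memLp : ∀ n k, MemLp (fun ω => (A 0 ω n k : ℝ)) 2 μ
  mean : ∀ n k, ∫ ω, (A 0 ω n k : ℝ) ∂μ = rate n k

/-- A run of the network under some non-anticipating routing decisions: `Q` are the overlay
backlogs, `X` the amounts injected into the tunnels, `serve` the packets forwarded by the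
underlay, which starts empty and executes the scheme `P`. -/
structure IsRun (P : ForwardingScheme) {Ω : Type*} [mΩ : MeasurableSpace Ω] (μ : Measure Ω)
    (ℱ : Filtration ℕ mΩ) (A Q : ℕ → Ω → N.Overlay → N.Commodity → ℕ)
    (X : ℕ → Ω → N.Tunnel → N.Commodity → ℕ) (serve : ℕ → Ω → Finset N.Packet) : Prop where
  measurable_init : ∀ n k, Measurable[ℱ 0] (fun ω => Q 0 ω n k)
  memLp_init : ∀ n k, MemLp (fun ω => (Q 0 ω n k : ℝ)) 2 μ
  measurable_injection : ∀ t l k, Measurable[ℱ (t + 1)] (fun ω => X t ω l k)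
  measurable_serve : ∀ t p, MeasurableSet[ℱ (t + 1)] {ω | p ∈ serve t ω}
  usable : ∀ t ω l k, ¬ N.usable l k → X t ω l k = 0
  executes : ∀ ω, Executes P (fun t => X t ω) (fun t => serve t ω)
  dest : ∀ t ω k, Q t ω (N.dest k) k = 0
  step : ∀ t ω n k, n ≠ N.dest k →
    (Q (t + 1) ω n k : ℤ) =
      max ((Q t ω n k : ℤ) - (∑ l with N.first l = n, X t ω l k : ℕ)
        + (∑ l with N.last l = n, exits (fun s => X s ω) (fun s => serve s ω) t l k : ℕ)
        + (A t ω n k : ℤ)) 0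

/-- In every slot an overlay node sends over each of its outgoing links at most as many packets
as the capacity of the link. -/
def RespectsCapacity {Ω : Type*} (X : ℕ → Ω → N.Tunnel → N.Commodity → ℕ) : Prop :=
  ∀ t ω (n : N.Overlay) (b : N.Node),
    ∑ l ∈ N.tunnelsThrough (Sum.inl n) b, ∑ k, X t ω l k ≤ N.cap (Sum.inl n) b

/-- The stability region: the closure of the set of all rate vectors of arrival sequences
for which some non-anticipating routing makes all overlay and underlay queues strongly stable. -/
def stabilityRegion (P : ForwardingScheme) : Set (N.Overlay → N.Commodity → ℝ) :=
  closure {rate | ∃ (Ω : Type) (mΩ : MeasurableSpace Ω) (μ : Measure Ω)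
    (ℱ : Filtration ℕ mΩ) (A Q : ℕ → Ω → N.Overlay → N.Commodity → ℕ)
    (X : ℕ → Ω → N.Tunnel → N.Commodity → ℕ) (serve : ℕ → Ω → Finset N.Packet),
    IsProbabilityMeasure μ ∧ N.IsArrivalSequence μ ℱ rate A ∧ N.IsRun P μ ℱ A Q X serve ∧
    N.RespectsCapacity X ∧
    (∀ n k, StronglyStable μ (fun t ω => Q t ω n k)) ∧
    ∀ e, StronglyStable μ
      (fun t ω => (queue (fun s => X s ω) (fun s => serve s ω) t e).card)}

/-- Overlay node `n` is an end of a tunnel that commodity `k` may use. -/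
def Carries (n : N.Overlay) (k : N.Commodity) : Prop :=
  ∃ l, N.usable l k ∧ (N.first l = n ∨ N.last l = n)

/-- `rate` is inside the stability region: it stays in the region after increasing
the rate of each commodity by some `ε > 0` at all nodes that can carry it. -/
def InsideRegion (P : ForwardingScheme) (rate : N.Overlay → N.Commodity → ℝ) : Prop :=
  ∃ ε : ℝ, 0 < ε ∧ ∃ rate' ∈ N.stabilityRegion P,
    (∀ n k, rate n k ≤ rate' n k) ∧ ∀ n k, N.Carries n k → rate n k + ε ≤ rate' n k

/-- The feasible set of the linear program: nonnegative tunnel flows that satisfy the tunnel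
capacity constraints. -/
def IsFeasible (F : N.Tunnel → N.Commodity → ℝ) : Prop :=
  (∀ l k, 0 ≤ F l k) ∧ (∀ l k, ¬ N.usable l k → F l k = 0) ∧
    ∀ a b : N.Node, 0 < N.cap a b → ∑ l ∈ N.tunnelsThrough a b, ∑ k, F l k ≤ N.cap a b

/-- The objective: flows weighted by the differential backlogs. -/
def objective (Q : N.Overlay → N.Commodity → ℕ) (F : N.Tunnel → N.Commodity → ℝ) : ℝ :=
  ∑ l, ∑ k, F l k * ((Q (N.first l) k : ℝ) - (Q (N.last l) k : ℝ))

/-- `F` solves the linear program for the backlogs `Q`. -/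
def IsLPSolution (Q : N.Overlay → N.Commodity → ℕ) (F : N.Tunnel → N.Commodity → ℝ) : Prop :=
  N.IsFeasible F ∧ ∀ G, N.IsFeasible G → N.objective Q G ≤ N.objective Q F

/-- The centralized policy with frame length `T`.  At the beginning `j * T` of frame `j` a solution
`F` of the linear program for the current backlogs is taken and approximated, up to `δ`, by
rates `p / q` that again satisfy the tunnel capacity constraints, strictly on links with an
underlay queue.  Then `S` schedules `p` packets in every `q` slots of the frame (at most `p` in
the remaining slots, if `q` does not divide `T`).  The scheduled packets are sent; a node whose
backlog is too small may send fewer, but at least as many as its backlog. -/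
structure IsCentralizedPolicy (T q : ℕ) (δ : ℝ) {Ω : Type*} [mΩ : MeasurableSpace Ω]
    (ℱ : Filtration ℕ mΩ) (Q : ℕ → Ω → N.Overlay → N.Commodity → ℕ)
    (X S p : ℕ → Ω → N.Tunnel → N.Commodity → ℕ) : Prop where
  measurable : ∀ j l k, Measurable[ℱ (j * T)] (fun ω => p j ω l k)
  approx : ∀ j ω, ∃ F, N.IsLPSolution (Q (j * T) ω) F ∧ ∀ l k, |(p j ω l k : ℝ) / q - F l k| ≤ δ
  feasible : ∀ j ω, N.IsFeasible (fun l k => (p j ω l k : ℝ) / q)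
  strict : ∀ j ω (u : N.Under) (b : N.Node), 0 < N.cap (Sum.inr u) b →
    ∑ l ∈ N.tunnelsThrough (Sum.inr u) b, ∑ k, (p j ω l k : ℝ) / q < N.cap (Sum.inr u) b
  block : ∀ j ω l k m, (m + 1) * q ≤ T →
    ∑ s ∈ Finset.Ico (m * q) ((m + 1) * q), S (j * T + s) ω l k = p j ω l k
  remainder : ∀ j ω l k,
    ∑ s ∈ Finset.Ico (T / q * q) T, S (j * T + s) ω l k ≤ p j ω l k
  sent_le : ∀ t ω l k, X t ω l k ≤ S t ω l k
  sent_ge : ∀ t ω n k,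
    min (∑ l with N.first l = n, S t ω l k) (Q t ω n k) ≤ ∑ l with N.first l = n, X t ω l k

end OverlayNetwork

/-! ### Packet counts in the underlay -/

namespace OverlayNetwork

variable {N : OverlayNetwork}

/-! The proof is a max-weight drift argument over frames, with the underlay replaced by a bounded
perturbation.

A rate inside the region admits a static flow with slack. Under any stabilizing routing, the mean
injections up to a late time at which the expected total backlog is small, divided by that time,
almost satisfy the link capacities and the balance inequalities at the overlay nodes
(`IsRun.exists_flow`). The error is of order backlog over time, so arbitrarily small. Scaling the
flow down slightly makes the capacities exact and costs only part of the margin `ε`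
(`InsideRegion.exists_feasible`).

The underlay is deterministic under the policy. Since the scheduled counts are integers and strictly
below capacity on underlay links, every block of `q` slots leaves one packet of room on each such
link. This makes the injections a bounded adversary whose window and rate depend only on `q` and the
capacities (`IsCentralizedPolicy.boundedAdversary`). Universal stability then bounds the underlay
queues independently of the frame length, which may therefore be chosen afterwards, large compared
with this bound.

For the overlay, the Lyapunov function is the sum of squared backlogs at frame starts
(`IsCentralizedPolicy.sum_sq_backlog_le`). Up to a bounded error, a frame moves `T` times the
scheduled rates, and these are nearly optimal for the linear program, so they do nearly as well as
the static flow with slack (`IsCentralizedPolicy.sum_flow_le`). Rate approximation, incomplete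
blocks and packets in transit use up only part of the slack, so the drift is negative for large
backlogs. Independence of arrivals from the past removes the fluctuation term in expectation;
telescoping bounds the average backlog at frame starts, and moment bounds extend this to all slots.
-/

theorem route_length (l : N.Tunnel) : (N.route l).length = (N.inner l).length := by
  simp [route, links, path]

theorem mem_tunnelsThrough {a b : N.Node} {l : N.Tunnel} :
    l ∈ N.tunnelsThrough a b ↔ (a, b) ∈ N.links l := by
  rw [tunnelsThrough, Finset.mem_filter, List.mem_toFinset]
  simp

theorem exists_first_link (l : N.Tunnel) :
    ∃ b, 0 < N.cap (Sum.inl (N.first l)) b ∧ l ∈ N.tunnelsThrough (Sum.inl (N.first l)) b := by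
  have hc := N.isChain l
  cases h : N.inner l with
  | nil =>
    refine ⟨Sum.inl (N.last l), ?_, ?_⟩
    · simpa [h] using hc
    · rw [mem_tunnelsThrough]
      simp [links, path, h]
  | cons u us =>
    refine ⟨Sum.inr u, ?_, ?_⟩
    · rw [h] at hc
      simp only [List.map_cons, List.cons_append, List.isChain_cons_cons] at hc
      exact hc.1
    · rw [mem_tunnelsThrough]
      simp [links, path, h]

/-- Dropping the first link loses nothing here, because that link leaves an overlay node. -/
theorem mem_route_of_mem_links {l : N.Tunnel} {u : N.Under} {b : N.Node}
    (h : (Sum.inr u, b) ∈ N.links l) : (Sum.inr u, b) ∈ N.route l := by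
  unfold route
  unfold links path at h ⊢
  cases hi : (N.inner l) with
  | nil => simp [hi] at h
  | cons v vs =>
    rw [hi] at h
    simp only [List.map_cons, List.cons_append, List.tail_cons, List.zip_cons_cons,
      List.mem_cons, Prod.mk.injEq, reduceCtorEq, false_and, false_or] at h ⊢
    exact h

section Transport

variable {X : N.Injection} {serve : ℕ → Finset N.Packet} {t : ℕ} {p : N.Packet}

theorem hops_zero : hops serve 0 p = 0 := by simp [hops]

theorem hops_succ :
    hops serve (t + 1) p = hops serve t p + if p ∈ serve t then 1 else 0 := by
  unfold hops
  rw [Finset.range_add_one, Finset.filter_insert]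
  split_ifs
  · rw [Finset.card_insert_of_notMem (by simp)]
  · simp

theorem mem_injected :
    p ∈ injected X t ↔ p.1.1 < t ∧ p.2 < X p.1.1 p.1.2.1 p.1.2.2 := by
  simp [injected]

theorem WorkConserving.exists_mem_queue (h : WorkConserving X serve) (hp : p ∈ serve t) :
    ∃ e, p ∈ queue X serve t e :=
  (h t).1 p hp

theorem WorkConserving.mem_injected_of_mem_serve (h : WorkConserving X serve)
    (hp : p ∈ serve t) : p ∈ injected X t := by
  obtain ⟨e, he⟩ := h.exists_mem_queue hp
  exact (Finset.mem_filter.1 he).1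

/-- A packet joins a queue only in the slot after its injection, so the bound on `t` includes `p.1.1
+ 1`. -/
theorem WorkConserving.hops_eq_zero (h : WorkConserving X serve) (ht : t ≤ p.1.1 + 1) :
    hops serve t p = 0 := by
  unfold hops
  rw [Finset.card_eq_zero, Finset.filter_eq_empty_iff]
  intro s hs hps
  have := (mem_injected.1 (h.mem_injected_of_mem_serve hps)).1
  have := Finset.mem_range.1 hs
  omega

/-- The packets of commodity `k` injected into tunnel `l` before slot `t` that have not left the
underlay. -/
def inTransit (X : N.Injection) (serve : ℕ → Finset N.Packet) (t : ℕ) (l : N.Tunnel)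
    (k : N.Commodity) : Finset N.Packet :=
  (injected X t).filter (fun p => p.1.2 = (l, k) ∧ hops serve t p < (N.route l).length)

/-- Conservation in one slot: for a tunnel with underlay nodes, both sides count the same packets,
split on the left by whether they leave in slot `t` and on the right by whether they are injected in
slot `t`. A direct tunnel never has packets in transit. -/
theorem WorkConserving.card_inTransit_succ (h : WorkConserving X serve) (t : ℕ) (l : N.Tunnel)
    (k : N.Commodity) :
    (inTransit X serve (t + 1) l k).card + exits X serve t l k =
      (inTransit X serve t l k).card + X t l k := by
  unfold exits
  split_ifs with hl
  · have hr : (N.route l).length = 0 := by rw [route_length, hl]; rfl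
    simp [inTransit, hr]
  have hr : 0 < (N.route l).length := by
    rw [route_length]; exact List.length_pos_iff.2 hl
  have hnew : X t l k = ((Finset.range (X t l k)).map
      ⟨fun i => (⟨(t, l, k), i⟩ : N.Packet), fun i j hij => by simpa using hij⟩).card := by
    simp
  rw [hnew]
  rw [← Finset.card_union_of_disjoint, ← Finset.card_union_of_disjoint]
  · congr 1
    ext ⟨⟨s, l', k'⟩, i⟩
    simp only [inTransit, Finset.mem_union, Finset.mem_filter, Finset.mem_map, Finset.mem_range,
      mem_injected, Prod.mk.injEq]
    constructor
    · rintro (⟨⟨h1, h2⟩, ⟨rfl, rfl⟩, h3⟩ | ⟨h1, ⟨rfl, rfl⟩, h3⟩)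
      · rcases Nat.lt_succ_iff_lt_or_eq.1 h1 with h4 | rfl
        · left
          refine ⟨⟨h4, h2⟩, ⟨rfl, rfl⟩, ?_⟩
          rw [hops_succ] at h3
          omega
        · right
          exact ⟨i, h2, rfl⟩
      · left
        have := mem_injected.1 (h.mem_injected_of_mem_serve h1)
        exact ⟨this, ⟨rfl, rfl⟩, by omega⟩
    · rintro (⟨⟨h1, h2⟩, ⟨rfl, rfl⟩, h3⟩ | ⟨j, h1, h2⟩)
      · simp only [hops_succ]
        by_cases h4 : (⟨(s, l', k'), i⟩ : N.Packet) ∈ serve t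
        · simp only [h4, if_true]
          by_cases h5 : hops serve t (⟨(s, l', k'), i⟩ : N.Packet) + 1 = (N.route l').length
          · right; exact ⟨trivial, ⟨trivial, trivial⟩, h5⟩
          · left; exact ⟨⟨by omega, h2⟩, ⟨trivial, trivial⟩, by omega⟩
        · left
          simp only [h4, if_false]
          exact ⟨⟨by omega, h2⟩, ⟨trivial, trivial⟩, by omega⟩
      · cases h2
        left
        refine ⟨⟨by simp, h1⟩, ⟨rfl, rfl⟩, ?_⟩
        rw [h.hops_eq_zero (by simp)]
        exact hr
  · rw [Finset.disjoint_left]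
    rintro ⟨⟨s, l', k'⟩, i⟩ h1 h2
    have := (Finset.mem_filter.1 h1).2
    simp only [Finset.mem_map, Finset.mem_range] at h2
    obtain ⟨j, h2, h3⟩ := h2
    cases h3
    have := (mem_injected.1 (Finset.mem_filter.1 h1).1).1
    simp at this
  · rw [Finset.disjoint_left]
    intro p h1 h2
    have h3 := (Finset.mem_filter.1 h1).2.2
    obtain ⟨h4, h5, h6⟩ := Finset.mem_filter.1 h2
    rw [hops_succ, if_pos h4] at h3
    omega

/-- The total number of packets in the underlay queues. -/
def underlayBacklog (X : N.Injection) (serve : ℕ → Finset N.Packet) (t : ℕ) : ℕ :=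
  ∑ e : N.Node × N.Node, (queue X serve t e).card

theorem exists_mem_queue_of_hops_lt (hp : p ∈ injected X t)
    (hh : hops serve t p < (N.route p.1.2.1).length) : ∃ e, p ∈ queue X serve t e :=
  ⟨(N.route p.1.2.1)[hops serve t p], by
    rw [queue, Finset.mem_filter]
    exact ⟨hp, List.getElem?_eq_getElem hh⟩⟩

theorem card_inTransit_le (l : N.Tunnel) (k : N.Commodity) :
    (inTransit X serve t l k).card ≤ underlayBacklog X serve t := by
  refine (Finset.card_le_card (t := Finset.univ.biUnion (queue X serve t)) ?_).trans
    Finset.card_biUnion_le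
  intro p hp
  obtain ⟨h1, h2, h3⟩ := Finset.mem_filter.1 hp
  have hl : p.1.2.1 = l := by rw [h2]
  obtain ⟨e, he⟩ := exists_mem_queue_of_hops_lt h1 (serve := serve) (by rw [hl]; exact h3)
  exact Finset.mem_biUnion.2 ⟨e, Finset.mem_univ _, he⟩

theorem WorkConserving.sum_exits_le (h : WorkConserving X serve) (t i : ℕ) (l : N.Tunnel)
    (k : N.Commodity) :
    ∑ s ∈ Finset.range i, exits X serve (t + s) l k ≤
      (∑ s ∈ Finset.range i, X (t + s) l k) + underlayBacklog X serve t := by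
  have key : (inTransit X serve (t + i) l k).card
      + ∑ s ∈ Finset.range i, exits X serve (t + s) l k =
      (inTransit X serve t l k).card + ∑ s ∈ Finset.range i, X (t + s) l k := by
    induction i with
    | zero => simp
    | succ i ih =>
      have := h.card_inTransit_succ (t + i) l k
      rw [Finset.sum_range_succ, Finset.sum_range_succ, ← add_assoc t i 1]
      omega
  have := card_inTransit_le (X := X) (serve := serve) (t := t) l k
  omega

theorem WorkConserving.sum_injection_le (h : WorkConserving X serve) (t : ℕ) (l : N.Tunnel)
    (k : N.Commodity) :
    ∑ s ∈ Finset.range t, X s l k ≤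
      (∑ s ∈ Finset.range t, exits X serve s l k) + underlayBacklog X serve t := by
  have key : (inTransit X serve t l k).card + ∑ s ∈ Finset.range t, exits X serve s l k =
      ∑ s ∈ Finset.range t, X s l k := by
    induction t with
    | zero => simp [inTransit, injected]
    | succ t ih =>
      have := h.card_inTransit_succ t l k
      rw [Finset.sum_range_succ, Finset.sum_range_succ]
      omega
  have := card_inTransit_le (X := X) (serve := serve) (t := t) l k
  omega

theorem exists_mem_serve_of_lt_hops {i : ℕ} (hi : i < hops serve t p) :
    ∃ s < t, hops serve s p = i ∧ p ∈ serve s := by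
  induction t with
  | zero => simp [hops_zero] at hi
  | succ t ih =>
    by_cases h1 : i < hops serve t p
    · obtain ⟨s, hs, h2⟩ := ih h1
      exact ⟨s, by omega, h2⟩
    · rw [hops_succ] at hi
      split_ifs at hi with h2
      · exact ⟨t, by omega, by omega, h2⟩
      · omega

/-- A packet whose tunnel uses the link has either crossed it before slot `t`, which at most the
capacity can do per slot, or is still in some underlay queue. -/
theorem WorkConserving.sum_injection_through_le (h : WorkConserving X serve) (t : ℕ)
    (u : N.Under) (b : N.Node) :
    ∑ s ∈ Finset.range t, ∑ l ∈ N.tunnelsThrough (Sum.inr u) b, ∑ k, X s l k ≤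
      t * N.cap (Sum.inr u) b + underlayBacklog X serve t := by
  classical
  set e : N.Node × N.Node := (Sum.inr u, b) with he
  set J : Finset N.Packet := ((Finset.range t ×ˢ (N.tunnelsThrough (Sum.inr u) b ×ˢ
    (Finset.univ : Finset N.Commodity))).sigma (fun x => Finset.range (X x.1 x.2.1 x.2.2)))
    with hJ
  have hcard : J.card =
      ∑ s ∈ Finset.range t, ∑ l ∈ N.tunnelsThrough (Sum.inr u) b, ∑ k, X s l k := by
    rw [hJ, Finset.card_sigma, Finset.sum_product]
    refine Finset.sum_congr rfl fun s _ => ?_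
    rw [Finset.sum_product]
    simp
  rw [← hcard]
  have hsub : J ⊆ (Finset.range t).biUnion (fun s => serve s ∩ queue X serve s e) ∪
      Finset.univ.biUnion (queue X serve t) := by
    intro p hp
    have hp' : (p.1.1 < t ∧ p.1.2.1 ∈ N.tunnelsThrough (Sum.inr u) b) ∧
        p.2 < X p.1.1 p.1.2.1 p.1.2.2 := by
      simpa [hJ] using hp
    obtain ⟨⟨h1, h2⟩, h3⟩ := hp'
    by_cases hh : hops serve t p < (N.route p.1.2.1).length
    · obtain ⟨e', he'⟩ := exists_mem_queue_of_hops_lt (mem_injected.2 ⟨h1, h3⟩) hh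
      exact Finset.mem_union_right _ (Finset.mem_biUnion.2 ⟨e', Finset.mem_univ _, he'⟩)
    -- The packet has completed its whole route, hence was forwarded at the position of `e` in it.
    · refine Finset.mem_union_left _ ?_
      have h4 : e ∈ N.route p.1.2.1 := by
        apply mem_route_of_mem_links
        exact mem_tunnelsThrough.1 h2
      obtain ⟨i, hi, hie⟩ := List.getElem_of_mem h4
      obtain ⟨s, hs, hsi, hps⟩ := exists_mem_serve_of_lt_hops (serve := serve) (t := t) (p := p)
        (i := i) (by omega)
      refine Finset.mem_biUnion.2 ⟨s, Finset.mem_range.2 hs, Finset.mem_inter.2 ⟨hps, ?_⟩⟩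
      rw [queue, Finset.mem_filter]
      refine ⟨h.mem_injected_of_mem_serve hps, ?_⟩
      rw [hsi, List.getElem?_eq_getElem hi, hie]
  refine (Finset.card_le_card hsub).trans ((Finset.card_union_le _ _).trans ?_)
  refine add_le_add ?_ Finset.card_biUnion_le
  refine Finset.card_biUnion_le.trans ?_
  refine (Finset.sum_le_card_nsmul _ _ (N.cap (Sum.inr u) b) fun s _ => ?_).trans (by simp)
  rw [(h s).2 e]
  exact min_le_left _ _

end Transport

end OverlayNetwork

/-! ### Measurability of queues and backlogs -/

/-- A countable type has only countably many finite subsets, so the events `G = F` suffice. -/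
theorem measurable_finset_card {Ω α : Type*} [MeasurableSpace Ω] [Countable α]
    {G : Ω → Finset α} (hG : ∀ a, MeasurableSet {ω | a ∈ G ω}) :
    Measurable (fun ω => (G ω).card) := by
  have hF : ∀ F : Finset α, MeasurableSet {ω | G ω = F} := by
    intro F
    have : {ω | G ω = F} = ⋂ a, {ω | a ∈ G ω ↔ a ∈ F} := by
      ext ω
      simp [Finset.ext_iff]
    rw [this]
    refine MeasurableSet.iInter fun a => ?_
    by_cases ha : a ∈ F
    · simpa [ha] using hG a
    · simp only [ha, iff_false]
      exact (hG a).compl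
  refine measurable_to_countable' fun n => ?_
  have : (fun ω => (G ω).card) ⁻¹' {n} =
      ⋃ F : {F : Finset α // F.card = n}, {ω | G ω = F.1} := by
    ext ω
    simp
  rw [this]
  exact MeasurableSet.iUnion fun F => hF F

namespace OverlayNetwork

variable {N : OverlayNetwork}

instance : Countable N.Packet :=
  inferInstanceAs (Countable (Σ _ : ℕ × N.Tunnel × N.Commodity, ℕ))

section History

variable {Ω : Type*} [MeasurableSpace Ω] {X : ℕ → Ω → N.Tunnel → N.Commodity → ℕ}
  {serve : ℕ → Ω → Finset N.Packet} {t : ℕ}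

theorem measurable_hops (hs : ∀ s < t, ∀ p, MeasurableSet {ω | p ∈ serve s ω}) (p : N.Packet) :
    Measurable (fun ω => hops (fun s => serve s ω) t p) := by
  induction t with
  | zero => simp only [hops_zero]; exact measurable_const
  | succ t ih =>
    simp only [hops_succ]
    exact (ih fun s h => hs s (by omega)).add
      (Measurable.ite (hs t (by omega) p) measurable_const measurable_const)

theorem measurableSet_mem_injected (hX : ∀ s < t, ∀ l k, Measurable (fun ω => X s ω l k))
    (p : N.Packet) : MeasurableSet {ω | p ∈ injected (fun s => X s ω) t} := by
  simp only [mem_injected]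
  by_cases hp : p.1.1 < t
  · simp only [hp, true_and]
    exact measurableSet_lt measurable_const (hX _ hp _ _)
  · simp [hp]

theorem measurable_card_queue (hX : ∀ s < t, ∀ l k, Measurable (fun ω => X s ω l k))
    (hs : ∀ s < t, ∀ p, MeasurableSet {ω | p ∈ serve s ω}) (e : N.Node × N.Node) :
    Measurable (fun ω => (queue (fun s => X s ω) (fun s => serve s ω) t e).card) := by
  refine measurable_finset_card fun p => ?_
  simp only [queue, Finset.mem_filter]
  exact (measurableSet_mem_injected hX p).inter
    (measurable_hops hs p (MeasurableSet.of_discrete (s := {i | (N.route p.1.2.1)[i]? = some e})))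

theorem measurable_exits (hX : ∀ s ≤ t, ∀ l k, Measurable (fun ω => X s ω l k))
    (hs : ∀ s ≤ t, ∀ p, MeasurableSet {ω | p ∈ serve s ω}) (l : N.Tunnel) (k : N.Commodity) :
    Measurable (fun ω => exits (fun s => X s ω) (fun s => serve s ω) t l k) := by
  unfold exits
  split_ifs
  · exact hX t le_rfl l k
  · refine measurable_finset_card fun p => ?_
    simp only [Finset.mem_filter]
    refine (hs t le_rfl p).inter ((MeasurableSet.const _).inter ?_)
    exact measurable_hops (fun s h => hs s h.le) p
      (MeasurableSet.of_discrete (s := {i | i + 1 = (N.route l).length}))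

end History

section Run

variable {P : ForwardingScheme} {Ω : Type*} [mΩ : MeasurableSpace Ω] {μ : Measure Ω}
  {ℱ : Filtration ℕ mΩ} {A Q : ℕ → Ω → N.Overlay → N.Commodity → ℕ}
  {X : ℕ → Ω → N.Tunnel → N.Commodity → ℕ} {serve : ℕ → Ω → Finset N.Packet}
  {rate : N.Overlay → N.Commodity → ℝ}

theorem IsRun.measurable_backlog (hr : N.IsRun P μ ℱ A Q X serve)
    (hA : N.IsArrivalSequence μ ℱ rate A) (t : ℕ) (n : N.Overlay) (k : N.Commodity) :
    Measurable[ℱ t] (fun ω => Q t ω n k) := by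
  induction t generalizing n k with
  | zero => exact hr.measurable_init n k
  | succ t ih =>
    by_cases hn : n = N.dest k
    · subst hn
      simp only [hr.dest]
      exact measurable_const
    · have hq : ∀ ω, Q (t + 1) ω n k = Int.toNat ((Q t ω n k : ℤ)
          - (∑ l with N.first l = n, X t ω l k : ℕ)
          + (∑ l with N.last l = n, exits (fun s => X s ω) (fun s => serve s ω) t l k : ℕ)
          + (A t ω n k : ℤ)) := by
        intro ω
        have := hr.step t ω n k hn
        omega
      simp only [hq]
      have hc : Measurable (fun m : ℕ => (m : ℤ)) := Measurable.of_discrete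
      have hle : ∀ s ≤ t, ℱ (s + 1) ≤ ℱ (t + 1) := fun s h => ℱ.mono (by omega)
      have h1 : Measurable[ℱ (t + 1)] (fun ω => Q t ω n k) :=
        (ih n k).mono (ℱ.mono (by omega)) le_rfl
      have h2 : Measurable[ℱ (t + 1)] (fun ω => ∑ l with N.first l = n, X t ω l k) :=
        Finset.measurable_sum _ fun l _ => hr.measurable_injection t l k
      have h3 : Measurable[ℱ (t + 1)] (fun ω => ∑ l with N.last l = n,
          exits (fun s => X s ω) (fun s => serve s ω) t l k) :=
        Finset.measurable_sum _ fun l _ => @measurable_exits N Ω (ℱ (t + 1)) X serve t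
          (fun s h l k => (hr.measurable_injection s l k).mono (hle s h) le_rfl)
          (fun s h p => hle s h _ (hr.measurable_serve s p)) l k
      have h4 : Measurable[ℱ (t + 1)] (fun ω => A t ω n k) :=
        (measurable_pi_apply k).comp ((measurable_pi_apply n).comp (hA.measurable t))
      exact (Measurable.of_discrete (f := Int.toNat)).comp
        ((((hc.comp h1).sub (hc.comp h2)).add (hc.comp h3)).add (hc.comp h4))

theorem IsRun.measurable_card_queue (hr : N.IsRun P μ ℱ A Q X serve) (t : ℕ)
    (e : N.Node × N.Node) :
    Measurable (fun ω => (queue (fun s => X s ω) (fun s => serve s ω) t e).card) :=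
  OverlayNetwork.measurable_card_queue
    (fun s _ l k => (hr.measurable_injection s l k).mono (ℱ.le _) le_rfl)
    (fun s _ p => ℱ.le _ _ (hr.measurable_serve s p)) e

end Run

end OverlayNetwork

/-! ### From the stability region to a static flow with slack -/

namespace OverlayNetwork

theorem StronglyStable.exists_bound {Ω : Type*} [MeasurableSpace Ω] {μ : Measure Ω}
    {Z : ℕ → Ω → ℕ} (h : StronglyStable μ Z) :
    ∃ M : ℕ, ∀ᶠ t : ℕ in atTop,
      ∑ s ∈ Finset.range t, ∫⁻ ω, (Z s ω : ℝ≥0∞) ∂μ ≤ (M : ℝ≥0∞) * t := by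
  obtain ⟨M, hM⟩ := ENNReal.exists_nat_gt (ne_of_lt h)
  refine ⟨M, ?_⟩
  filter_upwards [eventually_lt_of_limsup_lt hM, eventually_gt_atTop 0] with t ht ht0
  exact (ENNReal.div_le_iff (by exact_mod_cast ht0.ne') (by simp)).1 ht.le

/-- Were all terms from `a` on larger than the bound, the last `a + 1` of the first `2 * a + 1`
terms alone would exceed the allowed sum. -/
theorem frequently_le_of_sum_le {f : ℕ → ℝ≥0∞} {M : ℕ}
    (h : ∀ᶠ t : ℕ in atTop, ∑ s ∈ Finset.range t, f s ≤ (M : ℝ≥0∞) * t) :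
    ∃ᶠ t in atTop, f t ≤ 2 * (M + 1 : ℕ) := by
  intro hc
  obtain ⟨a, ha⟩ := eventually_atTop.1 (h.and hc)
  have h1 := (ha (2 * a + 1) (by omega)).1
  have h2 : ∑ s ∈ Finset.Ico a (2 * a + 1), (2 * (M + 1 : ℕ) : ℝ≥0∞)
      ≤ ∑ s ∈ Finset.range (2 * a + 1), f s := by
    refine (Finset.sum_le_sum fun s hs => ?_).trans
      (Finset.sum_le_sum_of_subset (s := Finset.Ico a (2 * a + 1)) fun s hs => ?_)
    · exact (not_le.1 (ha s (Finset.mem_Ico.1 hs).1).2).le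
    · exact Finset.mem_range.2 (Finset.mem_Ico.1 hs).2
  have h3 := h2.trans h1
  rw [Finset.sum_const, Nat.card_Ico, nsmul_eq_mul] at h3
  have h4 : (2 * a + 1 - a) * (2 * (M + 1)) ≤ M * (2 * a + 1) := by exact_mod_cast h3
  have h5 : 2 * a + 1 - a = a + 1 := by omega
  rw [h5] at h4
  nlinarith

theorem StronglyStable.exists_bound_sum {Ω ι : Type*} [MeasurableSpace Ω] {μ : Measure Ω}
    (I : Finset ι) {Z : ι → ℕ → Ω → ℕ} (hm : ∀ i t, Measurable (Z i t))
    (h : ∀ i, StronglyStable μ (Z i)) :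
    ∃ M : ℕ, ∀ᶠ t : ℕ in atTop, ∑ s ∈ Finset.range t,
      ∫⁻ ω, ((∑ i ∈ I, Z i s ω : ℕ) : ℝ≥0∞) ∂μ ≤ (M : ℝ≥0∞) * t := by
  choose M hM using fun i => (h i).exists_bound
  refine ⟨∑ i ∈ I, M i, ?_⟩
  have hall : ∀ᶠ t : ℕ in atTop, ∀ i ∈ I,
      ∑ s ∈ Finset.range t, ∫⁻ ω, (Z i s ω : ℝ≥0∞) ∂μ ≤ (M i : ℝ≥0∞) * t :=
    (eventually_all_finset I).2 fun i _ => hM i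
  filter_upwards [hall] with t ht
  have hc : Measurable (fun m : ℕ => (m : ℝ≥0∞)) := Measurable.of_discrete
  have h1 : ∀ s, ∫⁻ ω, ((∑ i ∈ I, Z i s ω : ℕ) : ℝ≥0∞) ∂μ =
      ∑ i ∈ I, ∫⁻ ω, (Z i s ω : ℝ≥0∞) ∂μ := by
    intro s
    push_cast
    exact lintegral_finsetSum I fun i _ => hc.comp (hm i s)
  simp only [h1]
  rw [Finset.sum_comm]
  push_cast
  rw [Finset.sum_mul]
  exact Finset.sum_le_sum ht

variable {N : OverlayNetwork}

theorem RespectsCapacity.injection_le {Ω : Type*} {X : ℕ → Ω → N.Tunnel → N.Commodity → ℕ}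
    (h : N.RespectsCapacity X) : ∃ C : ℕ, ∀ t ω l k, X t ω l k ≤ C := by
  choose b _ hb using N.exists_first_link
  refine ⟨∑ l, N.cap (Sum.inl (N.first l)) (b l), fun t ω l k => ?_⟩
  calc X t ω l k ≤ ∑ k, X t ω l k :=
        Finset.single_le_sum (f := fun k => X t ω l k) (fun _ _ => Nat.zero_le _)
          (Finset.mem_univ k)
    _ ≤ ∑ l ∈ N.tunnelsThrough (Sum.inl (N.first l)) (b l), ∑ k, X t ω l k :=
        Finset.single_le_sum (f := fun l => ∑ k, X t ω l k) (fun _ _ => Nat.zero_le _) (hb l)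
    _ ≤ N.cap (Sum.inl (N.first l)) (b l) := h t ω _ _
    _ ≤ _ := Finset.single_le_sum (f := fun l => N.cap (Sum.inl (N.first l)) (b l))
        (fun _ _ => Nat.zero_le _) (Finset.mem_univ l)

section Run

variable {P : ForwardingScheme} {Ω : Type*} [mΩ : MeasurableSpace Ω] {μ : Measure Ω}
  {ℱ : Filtration ℕ mΩ} {A Q : ℕ → Ω → N.Overlay → N.Commodity → ℕ}
  {X : ℕ → Ω → N.Tunnel → N.Commodity → ℕ} {serve : ℕ → Ω → Finset N.Packet}
  {rate : N.Overlay → N.Commodity → ℝ}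

theorem IsArrivalSequence.identDistrib_apply (hA : N.IsArrivalSequence μ ℱ rate A) (t : ℕ)
    (n : N.Overlay) (k : N.Commodity) :
    IdentDistrib (fun ω => (A t ω n k : ℝ)) (fun ω => (A 0 ω n k : ℝ)) μ μ :=
  (hA.identDistrib t).comp (u := fun a : N.Overlay → N.Commodity → ℕ => (a n k : ℝ))
    ((Measurable.of_discrete (f := fun m : ℕ => (m : ℝ))).comp
      ((measurable_pi_apply k).comp (measurable_pi_apply n)))

theorem IsArrivalSequence.memLp_apply (hA : N.IsArrivalSequence μ ℱ rate A) (t : ℕ)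
    (n : N.Overlay) (k : N.Commodity) : MemLp (fun ω => (A t ω n k : ℝ)) 2 μ :=
  (hA.identDistrib_apply t n k).memLp_iff.2 (hA.memLp n k)

theorem IsArrivalSequence.integral_apply (hA : N.IsArrivalSequence μ ℱ rate A) (t : ℕ)
    (n : N.Overlay) (k : N.Commodity) : ∫ ω, (A t ω n k : ℝ) ∂μ = rate n k := by
  rw [(hA.identDistrib_apply t n k).integral_eq, hA.mean]

theorem IsRun.workConserving (hr : N.IsRun P μ ℱ A Q X serve) (ω : Ω) :
    WorkConserving (fun t => X t ω) (fun t => serve t ω) :=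
  (hr.executes ω).1

/-- The positive part in the queue recursion can only raise the backlog, so summing the recursion
bounds arrivals plus exits; exits lag behind injections by at most the packets still in the
underlay. -/
theorem IsRun.arrivals_add_le (hr : N.IsRun P μ ℱ A Q X serve) (t : ℕ) (ω : Ω)
    {n : N.Overlay} {k : N.Commodity} (hn : n ≠ N.dest k) :
    ∑ s ∈ Finset.range t, A s ω n k
      + ∑ l with N.last l = n, ∑ s ∈ Finset.range t, X s ω l k ≤
    ∑ l with N.first l = n, ∑ s ∈ Finset.range t, X s ω l k + (Q t ω n k
      + Fintype.card N.Tunnel * underlayBacklog (fun s => X s ω) (fun s => serve s ω) t) := by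
  have h1 : ∑ s ∈ Finset.range t, A s ω n k + ∑ l with N.last l = n, ∑ s ∈ Finset.range t,
      exits (fun s => X s ω) (fun s => serve s ω) s l k ≤
      ∑ l with N.first l = n, ∑ s ∈ Finset.range t, X s ω l k + Q t ω n k := by
    induction t with
    | zero => simp
    | succ t ih =>
      simp only [Finset.sum_range_succ, Finset.sum_add_distrib]
      have := hr.step t ω n k hn
      omega
  have h2 : ∑ l with N.last l = n, ∑ s ∈ Finset.range t, X s ω l k ≤
      ∑ l with N.last l = n, ∑ s ∈ Finset.range t,
        exits (fun s => X s ω) (fun s => serve s ω) s l k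
      + Fintype.card N.Tunnel * underlayBacklog (fun s => X s ω) (fun s => serve s ω) t := by
    refine (Finset.sum_le_sum fun l _ => (hr.workConserving ω).sum_injection_le t l k).trans ?_
    rw [Finset.sum_add_distrib, Finset.sum_const, smul_eq_mul]
    gcongr
    exact Finset.card_le_univ _
  omega

/-- The flow is the expected time average of the injections up to a single well-chosen time. -/
theorem IsRun.exists_flow [IsProbabilityMeasure μ] (hA : N.IsArrivalSequence μ ℱ rate A)
    (hr : N.IsRun P μ ℱ A Q X serve) (hX : N.RespectsCapacity X)
    (hQ : ∀ n k, StronglyStable μ (fun t ω => Q t ω n k))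
    (hU : ∀ e, StronglyStable μ
      (fun t ω => (queue (fun s => X s ω) (fun s => serve s ω) t e).card))
    {η : ℝ} (hη : 0 < η) :
    ∃ F : N.Tunnel → N.Commodity → ℝ, (∀ l k, 0 ≤ F l k) ∧
      (∀ l k, ¬ N.usable l k → F l k = 0) ∧
      (∀ a b : N.Node, 0 < N.cap a b →
        ∑ l ∈ N.tunnelsThrough a b, ∑ k, F l k ≤ N.cap a b + η) ∧
      ∀ n k, n ≠ N.dest k → rate n k + ∑ l with N.last l = n, F l k ≤
        ∑ l with N.first l = n, F l k + η := by
  have hQm : ∀ t n k, Measurable (fun ω => Q t ω n k) := fun t n k =>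
    (hr.measurable_backlog hA t n k).mono (ℱ.le t) le_rfl
  have hXm : ∀ t l k, Measurable (fun ω => X t ω l k) := fun t l k =>
    (hr.measurable_injection t l k).mono (ℱ.le _) le_rfl
  have hc : Measurable (fun m : ℕ => (m : ℝ)) := Measurable.of_discrete
  -- the total backlog has bounded expectation at arbitrarily late times
  set Z : (N.Overlay × N.Commodity) ⊕ (N.Node × N.Node) → ℕ → Ω → ℕ := fun i t ω =>
    Sum.elim (fun x => Q t ω x.1 x.2)
      (fun e => (queue (fun s => X s ω) (fun s => serve s ω) t e).card) i with hZ
  set W : ℕ → Ω → ℕ := fun t ω => ∑ i, Z i t ω with hW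
  have hZm : ∀ i t, Measurable (Z i t) := by
    rintro (x | e) t
    · exact hQm t x.1 x.2
    · exact hr.measurable_card_queue t e
  have hWm : ∀ t, Measurable (W t) := fun t => Finset.measurable_sum _ fun i _ => hZm i t
  obtain ⟨M, hM⟩ := StronglyStable.exists_bound_sum Finset.univ hZm (μ := μ) (by
    rintro (x | e)
    · exact hQ x.1 x.2
    · exact hU e)
  -- The largest expected error in any constraint: the overlay backlog plus the underlay backlog
  -- once per tunnel, each at most `W t`. Requiring `t ≥ D / η` turns it into an error of at most
  -- `η` per slot.
  set D : ℝ := (1 + Fintype.card N.Tunnel) * (2 * (M + 1 : ℕ)) with hD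
  obtain ⟨t, hWt, ht0, htD⟩ := ((frequently_le_of_sum_le hM).and_eventually
    ((eventually_gt_atTop 0).and
      (tendsto_natCast_atTop_atTop.eventually_ge_atTop (D / η)))).exists
  have ht0' : (0 : ℝ) < t := by exact_mod_cast ht0
  have hDη : D ≤ η * t := by
    rw [div_le_iff₀ hη] at htD
    linarith
  have hWi : Integrable (fun ω => (W t ω : ℝ)) μ := by
    refine ⟨(hc.comp (hWm t)).aestronglyMeasurable, ?_⟩
    rw [hasFiniteIntegral_iff_ofReal (Eventually.of_forall fun ω => Nat.cast_nonneg _)]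
    simp only [ENNReal.ofReal_natCast]
    exact hWt.trans_lt (ENNReal.mul_lt_top (by simp) (by simp))
  have hWint : ∫ ω, (W t ω : ℝ) ∂μ ≤ 2 * (M + 1 : ℕ) := by
    rw [integral_eq_lintegral_of_nonneg_ae (Eventually.of_forall fun ω => Nat.cast_nonneg _)
      (hc.comp (hWm t)).aestronglyMeasurable]
    simp only [ENNReal.ofReal_natCast]
    refine ENNReal.toReal_le_of_le_ofReal (by positivity) (hWt.trans_eq ?_)
    rw [ENNReal.ofReal_mul (by norm_num), ENNReal.ofReal_natCast]
    simp
  have hQW : ∀ ω n k, Q t ω n k ≤ W t ω := fun ω n k =>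
    Finset.single_le_sum (f := fun i => Z i t ω) (fun _ _ => Nat.zero_le _)
      (Finset.mem_univ (Sum.inl (n, k)))
  have hUW : ∀ ω, underlayBacklog (fun s => X s ω) (fun s => serve s ω) t ≤ W t ω := by
    intro ω
    simp only [hW, hZ, Fintype.sum_sum_type]
    exact Nat.le_add_left _ _
  -- the flow
  set Y : N.Tunnel → N.Commodity → Ω → ℝ :=
    fun l k ω => ((∑ s ∈ Finset.range t, X s ω l k : ℕ) : ℝ) with hY
  obtain ⟨C, hC⟩ := hX.injection_le
  have hYi : ∀ l k, Integrable (Y l k) μ := by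
    intro l k
    refine Integrable.of_bound (C := ((t * C : ℕ) : ℝ))
      (hc.comp (Finset.measurable_sum _ fun s _ => hXm s l k)).aestronglyMeasurable
      (Eventually.of_forall fun ω => ?_)
    rw [Real.norm_natCast]
    exact_mod_cast (Finset.sum_le_card_nsmul _ _ C fun s _ => hC s ω l k).trans (by simp)
  have hlink : ∀ a b, 0 < N.cap a b → ∀ ω, ∑ l ∈ N.tunnelsThrough a b, ∑ k, Y l k ω ≤
      t * N.cap a b + W t ω := by
    intro a b hab ω
    have : ∑ l ∈ N.tunnelsThrough a b, ∑ k, ∑ s ∈ Finset.range t, X s ω l k ≤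
        t * N.cap a b + W t ω := by
      have hcomm : ∑ l ∈ N.tunnelsThrough a b, ∑ k, ∑ s ∈ Finset.range t, X s ω l k =
          ∑ s ∈ Finset.range t, ∑ l ∈ N.tunnelsThrough a b, ∑ k, X s ω l k :=
        (Finset.sum_congr rfl fun l _ => Finset.sum_comm).trans Finset.sum_comm
      rw [hcomm]
      rcases a with n | u
      · refine (Finset.sum_le_card_nsmul _ _ _ fun s _ => hX s ω n b).trans ?_
        simp
      · exact ((hr.workConserving ω).sum_injection_through_le t u b).trans
          (Nat.add_le_add_left (hUW ω) _)
    simp only [hY]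
    exact_mod_cast this
  refine ⟨fun l k => (∫ ω, Y l k ω ∂μ) / t, fun l k => ?_, fun l k hlk => ?_,
    fun a b hab => ?_, fun n k hn => ?_⟩
  · exact div_nonneg (integral_nonneg fun ω => Nat.cast_nonneg _) ht0'.le
  · have : ∀ ω, Y l k ω = 0 := fun ω => by
      simp [hY, hr.usable _ ω l k hlk]
    simp [this]
  · have h1 : ∑ l ∈ N.tunnelsThrough a b, ∑ k, (∫ ω, Y l k ω ∂μ) ≤
        t * N.cap a b + 2 * (M + 1 : ℕ) := by
      calc _ = ∫ ω, ∑ l ∈ N.tunnelsThrough a b, ∑ k, Y l k ω ∂μ := by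
            rw [integral_finsetSum _ fun l _ => integrable_finsetSum _ fun k _ => hYi l k]
            refine Finset.sum_congr rfl fun l _ => ?_
            rw [integral_finsetSum _ fun k _ => hYi l k]
        _ ≤ ∫ ω, ((t * N.cap a b : ℝ) + W t ω) ∂μ :=
            integral_mono (integrable_finsetSum _ fun l _ =>
              integrable_finsetSum _ fun k _ => hYi l k)
              ((integrable_const _).add hWi) (hlink a b hab)
        _ ≤ _ := by
            rw [integral_add (integrable_const _) hWi, integral_const]
            simp only [probReal_univ, one_smul]
            linarith
    simp only [← Finset.sum_div]
    rw [div_le_iff₀ ht0']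
    have h2 : (2 * (M + 1 : ℕ) : ℝ) ≤ D := by
      rw [hD]
      have : (0 : ℝ) ≤ Fintype.card N.Tunnel * (2 * (M + 1 : ℕ)) := by positivity
      linarith
    nlinarith
  · have hpath : ∀ ω, ∑ s ∈ Finset.range t, (A s ω n k : ℝ)
        + ∑ l with N.last l = n, Y l k ω ≤
        ∑ l with N.first l = n, Y l k ω + (1 + Fintype.card N.Tunnel) * (W t ω : ℝ) := by
      intro ω
      have h1 := hr.arrivals_add_le t ω hn
      have h2 : Q t ω n k + Fintype.card N.Tunnel *
          underlayBacklog (fun s => X s ω) (fun s => serve s ω) t ≤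
          (1 + Fintype.card N.Tunnel) * W t ω := by
        rw [add_mul, one_mul]
        exact add_le_add (hQW ω n k) (Nat.mul_le_mul_left _ (hUW ω))
      have h3 := h1.trans (Nat.add_le_add_left h2 _)
      simp only [hY]
      exact_mod_cast h3
    have hAi : ∀ s, Integrable (fun ω => (A s ω n k : ℝ)) μ := fun s =>
      (hA.memLp_apply s n k).integrable (by norm_num)
    have h1 := integral_mono
      ((integrable_finsetSum _ fun s _ => hAi s).add
        (integrable_finsetSum _ fun l _ => hYi l k))
      ((integrable_finsetSum _ fun l _ => hYi l k).add (hWi.const_mul _)) hpath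
    rw [integral_add' (integrable_finsetSum _ fun s _ => hAi s)
        (integrable_finsetSum _ fun l _ => hYi l k),
      integral_add' (integrable_finsetSum _ fun l _ => hYi l k) (hWi.const_mul _),
      integral_finsetSum _ fun s _ => hAi s, integral_finsetSum _ fun l _ => hYi l k,
      integral_finsetSum _ fun l _ => hYi l k, integral_const_mul] at h1
    simp only [hA.integral_apply, Finset.sum_const, Finset.card_range, nsmul_eq_mul] at h1
    have h2 : (1 + Fintype.card N.Tunnel : ℝ) * ∫ ω, (W t ω : ℝ) ∂μ ≤ D :=
      mul_le_mul_of_nonneg_left hWint (by positivity)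
    simp only [← Finset.sum_div]
    rw [← sub_nonneg]
    have h3 : (∑ l with N.first l = n, ∫ ω, Y l k ω ∂μ) / t + η
        - (rate n k + (∑ l with N.last l = n, ∫ ω, Y l k ω ∂μ) / t) =
        (∑ l with N.first l = n, ∫ ω, Y l k ω ∂μ + η * t
          - (t * rate n k + ∑ l with N.last l = n, ∫ ω, Y l k ω ∂μ)) / t := by
      field_simp
    rw [h3]
    exact div_nonneg (by linarith) ht0'.le

end Run

theorem exists_flow_of_mem_stabilityRegion {P : ForwardingScheme}
    {rate : N.Overlay → N.Commodity → ℝ} (h : rate ∈ N.stabilityRegion P) {η : ℝ} (hη : 0 < η) :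
    ∃ F : N.Tunnel → N.Commodity → ℝ, (∀ l k, 0 ≤ F l k) ∧
      (∀ l k, ¬ N.usable l k → F l k = 0) ∧
      (∀ a b : N.Node, 0 < N.cap a b →
        ∑ l ∈ N.tunnelsThrough a b, ∑ k, F l k ≤ N.cap a b + η) ∧
      ∀ n k, n ≠ N.dest k → rate n k + ∑ l with N.last l = n, F l k ≤
        ∑ l with N.first l = n, F l k + η := by
  obtain ⟨r, ⟨Ω, mΩ, μ, ℱ, A, Q, X, serve, hμ, hA, hr, hX, hQ, hU⟩, hd⟩ :=
    Metric.mem_closure_iff.1 h (η / 2) (by positivity)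
  obtain ⟨F, h0, h1, h2, h3⟩ := hr.exists_flow hA hX hQ hU (η := η / 2) (by positivity)
  refine ⟨F, h0, h1, fun a b hab => (h2 a b hab).trans (by linarith), fun n k hn => ?_⟩
  have h4 : |rate n k - r n k| < η / 2 :=
    ((dist_le_pi_dist (rate n) (r n) k).trans (dist_le_pi_dist rate r n)).trans_lt hd
  have h5 := (abs_lt.1 h4).2
  have h6 := h3 n k hn
  linarith

theorem InsideRegion.exists_feasible {P : ForwardingScheme}
    {rate : N.Overlay → N.Commodity → ℝ} (h : N.InsideRegion P rate) :
    ∃ ε : ℝ, 0 < ε ∧ (∃ G, N.IsFeasible G ∧ ∀ n k, n ≠ N.dest k → N.Carries n k →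
        rate n k + ε + ∑ l with N.last l = n, G l k ≤ ∑ l with N.first l = n, G l k) ∧
      ∀ n k, n ≠ N.dest k → ¬ N.Carries n k → rate n k ≤ 0 := by
  obtain ⟨ε, hε, rate', hmem, hle, hcar⟩ := h
  refine ⟨ε / 2, by positivity, ?_, fun n k hn hnc => ?_⟩
  · set R : ℝ := ∑ n, ∑ k, |rate n k| with hR
    have hRle : ∀ n k, rate n k ≤ R := fun n k =>
      (le_abs_self _).trans <| (Finset.single_le_sum (f := fun k => |rate n k|)
        (fun _ _ => abs_nonneg _) (Finset.mem_univ k)).trans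
        (Finset.single_le_sum (f := fun n => ∑ k, |rate n k|)
          (fun _ _ => Finset.sum_nonneg fun _ _ => abs_nonneg _) (Finset.mem_univ n))
    have hR0 : 0 ≤ R := Finset.sum_nonneg fun _ _ => Finset.sum_nonneg fun _ _ => abs_nonneg _
    -- Half of the margin pays for the defect `η` of the balance inequality and for scaling the flow
    -- by `1 / (1 + η)`, at every rate up to `R`.
    set η : ℝ := (ε / 2) / (1 + R + ε / 2) with hη
    have hη0 : 0 < η := by positivity
    have hηeq : η * (1 + R + ε / 2) = ε / 2 := div_mul_cancel₀ _ (by positivity)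
    obtain ⟨F, h0, h1, h2, h3⟩ := exists_flow_of_mem_stabilityRegion hmem hη0
    refine ⟨fun l k => F l k / (1 + η), ⟨fun l k => div_nonneg (h0 l k) (by positivity),
      fun l k hlk => by simp [h1 l k hlk], fun a b hab => ?_⟩, fun n k hn hc => ?_⟩
    · simp only [← Finset.sum_div]
      rw [div_le_iff₀ (by positivity)]
      -- Capacities of links are at least one, so the additive excess `η` is at most the relative
      -- excess removed by the scaling.
      have : (1 : ℝ) ≤ N.cap a b := by exact_mod_cast hab
      nlinarith [h2 a b hab]
    · simp only [← Finset.sum_div]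
      have h4 := h3 n k hn
      have h5 := hcar n k hc
      have h6 : η * rate n k ≤ η * R := mul_le_mul_of_nonneg_left (hRle n k) hη0.le
      have h7 : (rate n k + ε / 2) * (1 + η) + ∑ l with N.last l = n, F l k ≤
          ∑ l with N.first l = n, F l k := by nlinarith
      rw [le_div_iff₀ (by positivity), add_mul, div_mul_cancel₀ _ (by positivity)]
      exact h7
  -- No usable tunnel touches the pair, so its balance inequality contains no flow and only the
  -- arbitrary `η` remains.
  · refine (hle n k).trans (le_of_forall_pos_le_add fun η hη => ?_)
    obtain ⟨F, h0, h1, h2, h3⟩ := exists_flow_of_mem_stabilityRegion hmem hη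
    have h4 := h3 n k hn
    rw [Finset.sum_eq_zero (s := Finset.univ.filter fun l => N.last l = n),
      Finset.sum_eq_zero (s := Finset.univ.filter fun l => N.first l = n)] at h4
    · linarith
    · exact fun l hl => h1 l k fun hu => hnc ⟨l, hu, Or.inl (Finset.mem_filter.1 hl).2⟩
    · exact fun l hl => h1 l k fun hu => hnc ⟨l, hu, Or.inr (Finset.mem_filter.1 hl).2⟩

end OverlayNetwork

/-! ### Blocks, windows and the bounded adversary -/

theorem sum_range_mul_eq_sum_blocks (f : ℕ → ℕ) (q m : ℕ) :
    ∑ s ∈ Finset.range (m * q), f s =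
      ∑ i ∈ Finset.range m, ∑ s ∈ Finset.Ico (i * q) ((i + 1) * q), f s := by
  induction m with
  | zero => simp
  | succ m ih =>
    rw [Finset.sum_range_succ, ← ih, Finset.range_eq_Ico, Finset.range_eq_Ico,
      Finset.sum_Ico_consecutive _ (Nat.zero_le _) (Nat.mul_le_mul_right _ (Nat.le_succ m))]

/-- Grouping slots by `s / q`, an interval meets at most `(b - a) / q + 2` blocks, and each,
including the incomplete last one, contributes at most `D`. -/
theorem sum_Ico_le_of_sum_block_le {f : ℕ → ℕ} {q T D a b : ℕ} (hq : 0 < q) (hb : b ≤ T)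
    (hblock : ∀ m, (m + 1) * q ≤ T → ∑ s ∈ Finset.Ico (m * q) ((m + 1) * q), f s ≤ D)
    (hrem : ∑ s ∈ Finset.Ico (T / q * q) T, f s ≤ D) :
    ∑ s ∈ Finset.Ico a b, f s ≤ ((b - a) / q + 2) * D := by
  rcases le_or_gt b a with hab | hab
  · simp [Finset.Ico_eq_empty_of_le hab]
  have hmaps : ∀ s ∈ Finset.Ico a b, s / q ∈ Finset.Icc (a / q) (b / q) := by
    intro s hs
    obtain ⟨h1, h2⟩ := Finset.mem_Ico.1 hs
    exact Finset.mem_Icc.2 ⟨Nat.div_le_div_right h1, Nat.div_le_div_right h2.le⟩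
  rw [← Finset.sum_fiberwise_of_maps_to hmaps]
  have hfiber : ∀ m ∈ Finset.Icc (a / q) (b / q),
      ∑ s ∈ Finset.Ico a b with s / q = m, f s ≤ D := by
    intro m _
    by_cases hm : (m + 1) * q ≤ T
    · refine (Finset.sum_le_sum_of_subset fun s hs => ?_).trans (hblock m hm)
      obtain ⟨h1, rfl⟩ := Finset.mem_filter.1 hs
      rw [Finset.mem_Ico]
      exact ⟨Nat.div_mul_le_self s q, Nat.lt_mul_of_div_lt (Nat.lt_succ_self _) hq⟩
    · refine (Finset.sum_le_sum_of_subset fun s hs => ?_).trans hrem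
      obtain ⟨h1, rfl⟩ := Finset.mem_filter.1 hs
      rw [Finset.mem_Ico]
      have h2 : T / q < s / q + 1 := (Nat.div_lt_iff_lt_mul hq).2 (not_le.1 hm)
      exact ⟨(Nat.mul_le_mul_right q (Nat.lt_succ_iff.1 h2)).trans (Nat.div_mul_le_self s q),
        (Finset.mem_Ico.1 h1).2.trans_le hb⟩
  refine (Finset.sum_le_card_nsmul _ _ D hfiber).trans ?_
  rw [smul_eq_mul, Nat.card_Icc]
  refine Nat.mul_le_mul_right _ ?_
  have h3 : b / q ≤ a / q + (b - a) / q + 1 := by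
    rw [← Nat.lt_succ_iff, Nat.div_lt_iff_lt_mul hq]
    have h4 := Nat.lt_div_mul_add hq (a := a)
    have h5 := Nat.lt_div_mul_add hq (a := b - a)
    rw [Nat.succ_eq_add_one]
    have h6 : (a / q + (b - a) / q + 1 + 1) * q = a / q * q + (b - a) / q * q + q + q := by ring
    omega
  rw [Nat.sub_le_iff_le_add]
  linarith

/-- A window no longer than a frame meets at most two frames. -/
theorem sum_window_le_of_sum_block_le {f : ℕ → ℕ} {q T D w : ℕ} (hq : 0 < q) (hT : 0 < T)
    (hw : w ≤ T)
    (hblock : ∀ j m, (m + 1) * q ≤ T →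
      ∑ s ∈ Finset.Ico (m * q) ((m + 1) * q), f (j * T + s) ≤ D)
    (hrem : ∀ j, ∑ s ∈ Finset.Ico (T / q * q) T, f (j * T + s) ≤ D) (t : ℕ) :
    ∑ s ∈ Finset.Ico t (t + w), f s ≤ (w / q + 4) * D := by
  have hframe : ∀ j a b, b ≤ T → ∑ s ∈ Finset.Ico (j * T + a) (j * T + b), f s ≤
      ((b - a) / q + 2) * D := by
    intro j a b hb
    rw [add_comm _ a, add_comm _ b, ← Finset.sum_Ico_add]
    exact sum_Ico_le_of_sum_block_le hq hb (hblock j) (hrem j)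
  have hlt := Nat.mod_lt t hT
  obtain ⟨j, a, ha, rfl⟩ : ∃ j a, a < T ∧ t = j * T + a :=
    ⟨t / T, t % T, hlt, (Nat.div_add_mod' t T).symm⟩
  rcases le_or_gt (a + w) T with h | h
  · rw [add_assoc]
    refine (hframe j a (a + w) h).trans (Nat.mul_le_mul_right _ ?_)
    rw [Nat.add_sub_cancel_left]
    omega
  -- The window is cut at the frame boundary. Each piece costs two extra blocks, and the floors of
  -- the two lengths add up to at most `w / q`.
  · rw [← Finset.sum_Ico_consecutive f (n := j * T + T) (by omega) (by omega)]
    have h1 := hframe j a T le_rfl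
    have h2 := hframe (j + 1) 0 (a + w - T) (by omega)
    have h3 : (j + 1) * T = j * T + T := by ring
    rw [h3, add_zero, Nat.sub_zero, show j * T + T + (a + w - T) = j * T + a + w by omega] at h2
    refine (add_le_add h1 h2).trans ?_
    rw [← add_mul]
    refine Nat.mul_le_mul_right _ ?_
    have h4 : (T - a) / q + (a + w - T) / q ≤ (T - a + (a + w - T)) / q :=
      Nat.div_add_div_le_add_div
    rw [show T - a + (a + w - T) = w by omega] at h4
    omega

namespace OverlayNetwork

variable {N : OverlayNetwork}

theorem exists_cap_le (N : OverlayNetwork) : ∃ C : ℕ, 0 < C ∧ ∀ a b, N.cap a b ≤ C := by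
  refine ⟨1 + ∑ a, ∑ b, N.cap a b, by omega, fun a b => ?_⟩
  have h1 := Finset.single_le_sum (f := fun b => N.cap a b) (fun _ _ => Nat.zero_le _)
    (Finset.mem_univ b)
  have h2 := Finset.single_le_sum (f := fun a => ∑ b, N.cap a b) (fun _ _ => Nat.zero_le _)
    (Finset.mem_univ a)
  exact h1.trans (h2.trans (Nat.le_add_left _ _))

theorem IsFeasible.le_of_cap_le {F : N.Tunnel → N.Commodity → ℝ} (hF : N.IsFeasible F) {C : ℕ}
    (hC : ∀ a b, N.cap a b ≤ C) (l : N.Tunnel) (k : N.Commodity) : F l k ≤ C := by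
  obtain ⟨b, hb, hl⟩ := exists_first_link l
  calc F l k ≤ ∑ k, F l k :=
        Finset.single_le_sum (f := fun k => F l k) (fun k _ => hF.1 l k) (Finset.mem_univ k)
    _ ≤ ∑ l ∈ N.tunnelsThrough (Sum.inl (N.first l)) b, ∑ k, F l k :=
        Finset.single_le_sum (f := fun l => ∑ k, F l k)
          (fun l _ => Finset.sum_nonneg fun k _ => hF.1 l k) hl
    _ ≤ N.cap (Sum.inl (N.first l)) b := hF.2.2 _ _ hb
    _ ≤ C := by exact_mod_cast hC _ _

section Policy

variable {T q : ℕ} {δ : ℝ} {Ω : Type*} [mΩ : MeasurableSpace Ω] {ℱ : Filtration ℕ mΩ}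
  {Q : ℕ → Ω → N.Overlay → N.Commodity → ℕ} {X S p : ℕ → Ω → N.Tunnel → N.Commodity → ℕ}

theorem IsCentralizedPolicy.le_sum_schedule (h : N.IsCentralizedPolicy T q δ ℱ Q X S p) (j : ℕ)
    (ω : Ω) (l : N.Tunnel) (k : N.Commodity) :
    T / q * p j ω l k ≤ ∑ s ∈ Finset.range T, S (j * T + s) ω l k ∧
    ∑ s ∈ Finset.range T, S (j * T + s) ω l k ≤ (T / q + 1) * p j ω l k := by
  have h1 : ∑ s ∈ Finset.range (T / q * q), S (j * T + s) ω l k = T / q * p j ω l k := by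
    rw [sum_range_mul_eq_sum_blocks (fun s => S (j * T + s) ω l k)]
    rw [Finset.sum_congr rfl fun m hm => h.block j ω l k m
      ((Nat.mul_le_mul_right q (Finset.mem_range.1 hm)).trans (Nat.div_mul_le_self T q))]
    simp
  have h2 := h.remainder j ω l k
  have h3 := Finset.sum_range_add_sum_Ico (fun s => S (j * T + s) ω l k) (Nat.div_mul_le_self T q)
  rw [add_mul, one_mul]
  omega

/-- One packet of room per block gains `8 * q * C` packets over the window, while the four extra
blocks cost fewer than `4 * q * c`. As `c ≤ C`, what remains covers the required gap `4 * q * c`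
below full capacity. The window and the rate do not involve `T`. -/
theorem IsCentralizedPolicy.boundedAdversary (h : N.IsCentralizedPolicy T q δ ℱ Q X S p)
    (hq : 0 < q) {C : ℕ} (hC0 : 0 < C) (hC : ∀ a b, N.cap a b ≤ C) (hT : 8 * q ^ 2 * C ≤ T)
    (ω : Ω) :
    BoundedAdversary (N := N) (8 * q ^ 2 * C) (1 - 1 / (2 * q * C)) (fun t => X t ω) := by
  intro t u b hcap
  set c := N.cap (Sum.inr u) b with hc
  set σ : ℕ → ℕ := fun s => ∑ l ∈ N.tunnelsThrough (Sum.inr u) b, ∑ k, S s ω l k with hσ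
  set π : ℕ → ℕ := fun j => ∑ l ∈ N.tunnelsThrough (Sum.inr u) b, ∑ k, p j ω l k with hπ
  have hq' : (0 : ℝ) < q := by exact_mod_cast hq
  have hC' : (0 : ℝ) < C := by exact_mod_cast hC0
  -- Strictness becomes a full packet of room because both sides are integers.
  have hπle : ∀ j, π j ≤ q * c - 1 := by
    intro j
    have h1 := h.strict j ω u b hcap
    simp only [← Finset.sum_div] at h1
    rw [div_lt_iff₀ hq'] at h1
    have h2 : π j < c * q := by
      simp only [hπ]
      exact_mod_cast h1
    rw [mul_comm] at h2
    omega
  have hwin : ∑ s ∈ Finset.Ico t (t + 8 * q ^ 2 * C), σ s ≤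
      (8 * q ^ 2 * C / q + 4) * (q * c - 1) := by
    refine sum_window_le_of_sum_block_le hq (lt_of_lt_of_le (by positivity) hT) hT
      (fun j m hm => ?_) (fun j => ?_) t
    · refine le_trans (le_of_eq ?_) (hπle j)
      simp only [hσ, hπ]
      rw [Finset.sum_comm]
      refine Finset.sum_congr rfl fun l _ => ?_
      rw [Finset.sum_comm]
      exact Finset.sum_congr rfl fun k _ => h.block j ω l k m hm
    · refine le_trans ?_ (hπle j)
      simp only [hσ, hπ]
      rw [Finset.sum_comm]
      refine Finset.sum_le_sum fun l _ => ?_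
      rw [Finset.sum_comm]
      exact Finset.sum_le_sum fun k _ => h.remainder j ω l k
  have hXS : ∑ s ∈ Finset.Ico t (t + 8 * q ^ 2 * C),
      ∑ l ∈ N.tunnelsThrough (Sum.inr u) b, ∑ k, X s ω l k ≤
      ∑ s ∈ Finset.Ico t (t + 8 * q ^ 2 * C), σ s :=
    Finset.sum_le_sum fun s _ => Finset.sum_le_sum fun l _ => Finset.sum_le_sum fun k _ =>
      h.sent_le s ω l k
  have hdiv : 8 * q ^ 2 * C / q = 8 * q * C := by
    rw [show 8 * q ^ 2 * C = 8 * q * C * q by ring, Nat.mul_div_cancel _ hq]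
  rw [hdiv] at hwin
  have hqc : 1 ≤ q * c := Nat.mul_pos hq hcap
  have h1 : ((∑ s ∈ Finset.Ico t (t + 8 * q ^ 2 * C),
      ∑ l ∈ N.tunnelsThrough (Sum.inr u) b, ∑ k, X s ω l k : ℕ) : ℝ) ≤
      (8 * q * C + 4) * (q * c - 1) := by
    refine (Nat.cast_le.2 (hXS.trans hwin)).trans (le_of_eq ?_)
    push_cast [Nat.cast_sub hqc]
    ring
  refine h1.trans ?_
  have h2 : (1 - 1 / (2 * q * C) : ℝ) * (8 * q ^ 2 * C : ℕ) * c =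
      8 * q ^ 2 * C * c - 4 * q * c := by
    push_cast
    field_simp
    ring
  rw [h2]
  have h3 : (c : ℝ) ≤ C := by exact_mod_cast hC _ _
  nlinarith [mul_le_mul_of_nonneg_left h3 hq'.le]

end Policy

end OverlayNetwork

/-! ### The quadratic drift over one frame -/

namespace OverlayNetwork

variable {N : OverlayNetwork}

theorem WorkConserving.exits_eq_zero {X : N.Injection} {serve : ℕ → Finset N.Packet}
    (h : WorkConserving X serve) {l : N.Tunnel} {k : N.Commodity} (hX : ∀ s, X s l k = 0)
    (t : ℕ) : exits X serve t l k = 0 := by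
  unfold exits
  split_ifs
  · exact hX t
  · rw [Finset.card_eq_zero, Finset.filter_eq_empty_iff]
    rintro ⟨⟨s, l', k'⟩, i⟩ hp ⟨h1, -⟩
    cases h1
    have h2 := (mem_injected.1 (h.mem_injected_of_mem_serve hp)).2
    simp [hX] at h2

open Classical in
/-- The node-commodity pairs whose backlogs the routing can influence. -/
noncomputable def active (N : OverlayNetwork) : Finset (N.Overlay × N.Commodity) :=
  Finset.univ.filter fun x => x.1 ≠ N.dest x.2 ∧ N.Carries x.1 x.2

theorem mem_active {x : N.Overlay × N.Commodity} :
    x ∈ N.active ↔ x.1 ≠ N.dest x.2 ∧ N.Carries x.1 x.2 := by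
  classical
  simp [active]

/-- Regrouping the objective by nodes. Inactive pairs drop out: backlog vanishes at destinations,
and flow vanishes at pairs without usable tunnels. -/
theorem objective_eq_sum_active {Q : N.Overlay → N.Commodity → ℕ}
    {F : N.Tunnel → N.Commodity → ℝ} (hQ : ∀ k, Q (N.dest k) k = 0)
    (hF : ∀ l k, ¬ N.usable l k → F l k = 0) :
    N.objective Q F = ∑ x ∈ N.active, (Q x.1 x.2 : ℝ) *
      (∑ l with N.first l = x.1, F l x.2 - ∑ l with N.last l = x.1, F l x.2) := by
  have h1 : ∑ x ∈ N.active, (Q x.1 x.2 : ℝ) *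
      (∑ l with N.first l = x.1, F l x.2 - ∑ l with N.last l = x.1, F l x.2) =
      ∑ x : N.Overlay × N.Commodity, (Q x.1 x.2 : ℝ) *
      (∑ l with N.first l = x.1, F l x.2 - ∑ l with N.last l = x.1, F l x.2) := by
    refine Finset.sum_subset (Finset.subset_univ _) fun x _ hx => ?_
    rw [mem_active, not_and_or, not_not] at hx
    rcases hx with hx | hx
    · rw [hx, hQ]
      simp
    · rw [Finset.sum_eq_zero (s := Finset.univ.filter fun l => N.last l = x.1),
        Finset.sum_eq_zero (s := Finset.univ.filter fun l => N.first l = x.1)]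
      · simp
      · exact fun l hl => hF l _ fun hu => hx ⟨l, hu, Or.inl (Finset.mem_filter.1 hl).2⟩
      · exact fun l hl => hF l _ fun hu => hx ⟨l, hu, Or.inr (Finset.mem_filter.1 hl).2⟩
  have h2 : ∀ (e : N.Tunnel → N.Overlay) (k : N.Commodity),
      ∑ n, (Q n k : ℝ) * ∑ l with e l = n, F l k = ∑ l, F l k * Q (e l) k := by
    intro e k
    rw [← Finset.sum_fiberwise Finset.univ e (fun l => F l k * (Q (e l) k : ℝ))]
    refine Finset.sum_congr rfl fun n _ => ?_
    rw [Finset.mul_sum]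
    refine Finset.sum_congr rfl fun l hl => ?_
    rw [(Finset.mem_filter.1 hl).2, mul_comm]
  rw [h1, Fintype.sum_prod_type, Finset.sum_comm, objective, Finset.sum_comm]
  refine Finset.sum_congr rfl fun k _ => ?_
  simp only [mul_sub, Finset.sum_sub_distrib]
  rw [h2, h2]

section Policy

variable {P : ForwardingScheme} {T q : ℕ} {δ : ℝ} {Ω : Type*} [mΩ : MeasurableSpace Ω]
  {μ : Measure Ω} {ℱ : Filtration ℕ mΩ} {A Q : ℕ → Ω → N.Overlay → N.Commodity → ℕ}
  {X S p : ℕ → Ω → N.Tunnel → N.Commodity → ℕ} {serve : ℕ → Ω → Finset N.Packet}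
  {rate : N.Overlay → N.Commodity → ℝ}

/-- In each slot a node sends everything scheduled or at least its whole backlog, so scheduled
amounts may be subtracted, truncated at zero, even if not actually sent. Exits exceed the scheduled
inflow by at most the packets in transit at the start, `β` per tunnel. -/
theorem IsCentralizedPolicy.backlog_add_le (h : N.IsCentralizedPolicy T q δ ℱ Q X S p)
    (hr : N.IsRun P μ ℱ A Q X serve) {β : ℕ}
    (hβ : ∀ t ω, underlayBacklog (fun s => X s ω) (fun s => serve s ω) t ≤ β)
    {n : N.Overlay} {k : N.Commodity} (hn : n ≠ N.dest k) (t i : ℕ) (ω : Ω) :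
    Q (t + i) ω n k ≤
      (Q t ω n k - ∑ l with N.first l = n, ∑ s ∈ Finset.range i, S (t + s) ω l k)
      + (∑ l with N.last l = n, ∑ s ∈ Finset.range i, S (t + s) ω l k
        + Fintype.card N.Tunnel * β)
      + ∑ s ∈ Finset.range i, A (t + s) ω n k := by
  have h1 : Q (t + i) ω n k ≤
      (Q t ω n k - ∑ l with N.first l = n, ∑ s ∈ Finset.range i, S (t + s) ω l k)
      + ∑ l with N.last l = n, ∑ s ∈ Finset.range i,
        exits (fun s => X s ω) (fun s => serve s ω) (t + s) l k
      + ∑ s ∈ Finset.range i, A (t + s) ω n k := by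
    induction i with
    | zero => simp
    | succ i ih =>
      simp only [Finset.sum_range_succ, Finset.sum_add_distrib]
      have h2 := hr.step (t + i) ω n k hn
      have h3 := h.sent_ge (t + i) ω n k
      rw [← add_assoc]
      omega
  have h2 : ∑ l with N.last l = n, ∑ s ∈ Finset.range i,
        exits (fun s => X s ω) (fun s => serve s ω) (t + s) l k ≤
      ∑ l with N.last l = n, ∑ s ∈ Finset.range i, S (t + s) ω l k
        + Fintype.card N.Tunnel * β := by
    have h3 : ∀ l ∈ Finset.univ.filter (fun l => N.last l = n), ∑ s ∈ Finset.range i,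
        exits (fun s => X s ω) (fun s => serve s ω) (t + s) l k ≤
        ∑ s ∈ Finset.range i, S (t + s) ω l k + β := fun l _ =>
      ((hr.workConserving ω).sum_exits_le t i l k).trans
        (add_le_add (Finset.sum_le_sum fun s _ => h.sent_le _ ω l k) (hβ t ω))
    refine (Finset.sum_le_sum h3).trans ?_
    rw [Finset.sum_add_distrib, Finset.sum_const, smul_eq_mul]
    gcongr
    exact Finset.card_le_univ _
  omega

/-- Only the incomplete last block deviates from the constant rate, and one block carries at most `q
* C` packets. -/
theorem IsCentralizedPolicy.abs_sum_schedule_sub_le (h : N.IsCentralizedPolicy T q δ ℱ Q X S p)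
    (hq : 0 < q) {C : ℕ} (hC : ∀ a b, N.cap a b ≤ C) (j : ℕ) (ω : Ω) (l : N.Tunnel)
    (k : N.Commodity) :
    |(∑ s ∈ Finset.range T, S (j * T + s) ω l k : ℕ) - T * ((p j ω l k : ℝ) / q)| ≤ q * C := by
  obtain ⟨h1, h2⟩ := h.le_sum_schedule j ω l k
  have hf : (p j ω l k : ℝ) / q ≤ C := (h.feasible j ω).le_of_cap_le hC l k
  have hf0 : 0 ≤ (p j ω l k : ℝ) / q := (h.feasible j ω).1 l k
  have hq' : (0 : ℝ) < q := by exact_mod_cast hq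
  set f : ℝ := (p j ω l k : ℝ) / q with hfdef
  have hp : (p j ω l k : ℝ) = q * f := by rw [hfdef]; field_simp
  have h1' : ((T / q : ℕ) : ℝ) * (q * f) ≤ (∑ s ∈ Finset.range T, S (j * T + s) ω l k : ℕ) := by
    rw [← hp]
    exact_mod_cast h1
  have h2' : ((∑ s ∈ Finset.range T, S (j * T + s) ω l k : ℕ) : ℝ) ≤
      ((T / q : ℕ) + 1) * (q * f) := by
    rw [← hp]
    exact_mod_cast h2
  have h3 : ((T / q : ℕ) : ℝ) * q ≤ T := by exact_mod_cast Nat.div_mul_le_self T q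
  have h4 : (T : ℝ) ≤ ((T / q : ℕ) : ℝ) * q + q := by
    exact_mod_cast (Nat.lt_div_mul_add hq (a := T)).le
  have h5 := mul_le_mul_of_nonneg_right h3 hf0
  have h6 := mul_le_mul_of_nonneg_right h4 hf0
  have h7 := mul_le_mul_of_nonneg_left hf hq'.le
  rw [abs_le]
  constructor <;> nlinarith

theorem IsCentralizedPolicy.sum_schedule_le (h : N.IsCentralizedPolicy T q δ ℱ Q X S p)
    (hq : 0 < q) {C : ℕ} (hC : ∀ a b, N.cap a b ≤ C) (j : ℕ) (ω : Ω) {i : ℕ} (hi : i ≤ T)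
    (I : Finset N.Tunnel) (k : N.Commodity) :
    ∑ l ∈ I, ∑ s ∈ Finset.range i, S (j * T + s) ω l k ≤
      Fintype.card N.Tunnel * ((T + q) * C) := by
  refine (Finset.sum_le_card_nsmul _ _ ((T + q) * C) fun l _ => ?_).trans ?_
  · refine (Finset.sum_le_sum_of_subset (Finset.range_mono hi)).trans ?_
    have h1 := (abs_le.1 (h.abs_sum_schedule_sub_le hq hC j ω l k)).2
    have h2 : (p j ω l k : ℝ) / q ≤ C := (h.feasible j ω).le_of_cap_le hC l k
    have h3 := mul_le_mul_of_nonneg_left h2 (Nat.cast_nonneg (α := ℝ) T)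
    have h4 : ((∑ s ∈ Finset.range T, S (j * T + s) ω l k : ℕ) : ℝ) ≤ (T + q) * C := by
      linarith
    exact_mod_cast h4
  · rw [smul_eq_mul]
    exact Nat.mul_le_mul_right _ (Finset.card_le_univ _)

theorem sq_le_of_le_max_add {y x s a : ℝ} (hy : 0 ≤ y) (hx : 0 ≤ x) (hs : 0 ≤ s) (ha : 0 ≤ a)
    (h : y ≤ max (x - s) 0 + a) : y ^ 2 ≤ x ^ 2 + s ^ 2 + a ^ 2 + 2 * x * (a - s) := by
  rcases le_total (x - s) 0 with h1 | h1
  · rw [max_eq_right h1] at h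
    nlinarith [mul_nonneg hx ha, sq_nonneg (x - s)]
  · rw [max_eq_left h1] at h
    nlinarith [mul_nonneg hs ha]

/-- The linear program makes its solution at least as good as the static flow `G`, which has slack
`ε`. Replacing the solution by `p / q` changes inflow and outflow of a node by at most `δ` per
tunnel each, which costs `ε / 2`. -/
theorem IsCentralizedPolicy.sum_flow_le (h : N.IsCentralizedPolicy T q δ ℱ Q X S p)
    (hdest : ∀ t ω k, Q t ω (N.dest k) k = 0) {ε : ℝ} {G : N.Tunnel → N.Commodity → ℝ}
    (hG : N.IsFeasible G)
    (hslack : ∀ n k, n ≠ N.dest k → N.Carries n k →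
      rate n k + ε + ∑ l with N.last l = n, G l k ≤ ∑ l with N.first l = n, G l k)
    (hδ0 : 0 ≤ δ) (hδ : 2 * Fintype.card N.Tunnel * δ ≤ ε / 2) (j : ℕ) (ω : Ω) :
    ∑ x ∈ N.active, (Q (j * T) ω x.1 x.2 : ℝ) *
      (∑ l with N.last l = x.1, (p j ω l x.2 : ℝ) / q
        - ∑ l with N.first l = x.1, (p j ω l x.2 : ℝ) / q) ≤
    ∑ x ∈ N.active, (Q (j * T) ω x.1 x.2 : ℝ) * (-(rate x.1 x.2 + ε / 2)) := by
  obtain ⟨F, hF, hpF⟩ := h.approx j ω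
  have h1 := hF.2 G hG
  rw [objective_eq_sum_active (hdest _ ω) hG.2.1,
    objective_eq_sum_active (hdest _ ω) hF.1.2.1] at h1
  have hcard : ∀ (I : Finset N.Tunnel) (k : N.Commodity),
      |∑ l ∈ I, (p j ω l k : ℝ) / q - ∑ l ∈ I, F l k| ≤ Fintype.card N.Tunnel * δ := by
    intro I k
    rw [← Finset.sum_sub_distrib]
    refine (Finset.abs_sum_le_sum_abs _ _).trans ?_
    refine (Finset.sum_le_card_nsmul _ _ δ fun l _ => hpF l k).trans ?_
    rw [nsmul_eq_mul]
    gcongr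
    exact Finset.card_le_univ _
  have h2 : ∀ x ∈ N.active, (Q (j * T) ω x.1 x.2 : ℝ) *
      (∑ l with N.last l = x.1, (p j ω l x.2 : ℝ) / q
        - ∑ l with N.first l = x.1, (p j ω l x.2 : ℝ) / q) ≤
      (Q (j * T) ω x.1 x.2 : ℝ) * (-(rate x.1 x.2 + ε / 2)) +
      ((Q (j * T) ω x.1 x.2 : ℝ) *
        (∑ l with N.first l = x.1, G l x.2 - ∑ l with N.last l = x.1, G l x.2) -
      (Q (j * T) ω x.1 x.2 : ℝ) *
        (∑ l with N.first l = x.1, F l x.2 - ∑ l with N.last l = x.1, F l x.2)) := by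
    intro x hx
    have hx' := mem_active.1 hx
    rw [← mul_sub, ← mul_add]
    refine mul_le_mul_of_nonneg_left ?_ (Nat.cast_nonneg _)
    have h3 := hslack _ _ hx'.1 hx'.2
    have h4 := (abs_le.1 (hcard (Finset.univ.filter fun l => N.last l = x.1) x.2)).2
    have h5 := (abs_le.1 (hcard (Finset.univ.filter fun l => N.first l = x.1) x.2)).1
    linarith
  refine (Finset.sum_le_sum h2).trans ?_
  rw [Finset.sum_add_distrib, Finset.sum_sub_distrib]
  linarith

/-- Of the slack `ε`, the rate approximation takes `ε / 2`, and incomplete blocks together with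
packets in transit take `ε / 4` once `T` is large. The remaining `ε / 4` is doubled by the square.
-/
theorem IsCentralizedPolicy.sum_sq_backlog_le (h : N.IsCentralizedPolicy T q δ ℱ Q X S p)
    (hr : N.IsRun P μ ℱ A Q X serve) (hq : 0 < q) {β : ℕ}
    (hβ : ∀ t ω, underlayBacklog (fun s => X s ω) (fun s => serve s ω) t ≤ β)
    {C : ℕ} (hC : ∀ a b, N.cap a b ≤ C) {ε : ℝ} {G : N.Tunnel → N.Commodity → ℝ}
    (hG : N.IsFeasible G)
    (hslack : ∀ n k, n ≠ N.dest k → N.Carries n k →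
      rate n k + ε + ∑ l with N.last l = n, G l k ≤ ∑ l with N.first l = n, G l k)
    (hδ0 : 0 ≤ δ) (hδ : 2 * Fintype.card N.Tunnel * δ ≤ ε / 2)
    (hT : (2 * Fintype.card N.Tunnel * (q * C) + Fintype.card N.Tunnel * β : ℝ) ≤ T * (ε / 4)) :
    ∃ D : ℝ, ∀ j ω, ∑ x ∈ N.active, (Q ((j + 1) * T) ω x.1 x.2 : ℝ) ^ 2 ≤
      ∑ x ∈ N.active, ((Q (j * T) ω x.1 x.2 : ℝ) ^ 2 + D
        + 2 * (∑ s ∈ Finset.range T, (A (j * T + s) ω x.1 x.2 : ℝ)) ^ 2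
        + 2 * ((Q (j * T) ω x.1 x.2 : ℝ) *
          ((∑ s ∈ Finset.range T, (A (j * T + s) ω x.1 x.2 : ℝ)) - T * rate x.1 x.2))
        - T * (ε / 2) * Q (j * T) ω x.1 x.2) := by
  set m : ℕ := Fintype.card N.Tunnel with hm
  set σ : ℕ := m * ((T + q) * C) with hσ
  -- Here `σ` bounds what is scheduled out of or into a node during a frame; the squared inflow is
  -- split from the squared arrivals, which are unbounded and stay explicit.
  refine ⟨(σ : ℝ) ^ 2 + 2 * ((σ : ℝ) + m * β) ^ 2, fun j ω => ?_⟩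
  have key : ∀ x ∈ N.active, (Q ((j + 1) * T) ω x.1 x.2 : ℝ) ^ 2 ≤
      (Q (j * T) ω x.1 x.2 : ℝ) ^ 2 + ((σ : ℝ) ^ 2 + 2 * ((σ : ℝ) + m * β) ^ 2)
        + 2 * (∑ s ∈ Finset.range T, (A (j * T + s) ω x.1 x.2 : ℝ)) ^ 2
        + 2 * (Q (j * T) ω x.1 x.2 : ℝ) *
          ((∑ s ∈ Finset.range T, (A (j * T + s) ω x.1 x.2 : ℝ)) + T * (ε / 4))
        + 2 * T * ((Q (j * T) ω x.1 x.2 : ℝ) *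
          (∑ l with N.last l = x.1, (p j ω l x.2 : ℝ) / q
            - ∑ l with N.first l = x.1, (p j ω l x.2 : ℝ) / q)) := by
    intro x hx
    have h1 := h.backlog_add_le hr hβ (mem_active.1 hx).1 (j * T) T ω
    rw [show j * T + T = (j + 1) * T by ring, ← hm] at h1
    have hs := h.sum_schedule_le hq hC j ω le_rfl (Finset.univ.filter fun l => N.first l = x.1) x.2
    have hi := h.sum_schedule_le hq hC j ω le_rfl (Finset.univ.filter fun l => N.last l = x.1) x.2
    rw [← hm, ← hσ] at hs hi
    have happrox : ∀ I : Finset N.Tunnel,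
        |((∑ l ∈ I, ∑ s ∈ Finset.range T, S (j * T + s) ω l x.2 : ℕ) : ℝ)
          - T * ∑ l ∈ I, (p j ω l x.2 : ℝ) / q| ≤ m * (q * C) := by
      intro I
      rw [Nat.cast_sum, Finset.mul_sum, ← Finset.sum_sub_distrib]
      refine (Finset.abs_sum_le_sum_abs _ _).trans ?_
      refine (Finset.sum_le_card_nsmul _ _ (q * C : ℝ) fun l _ =>
        h.abs_sum_schedule_sub_le hq hC j ω l x.2).trans ?_
      rw [nsmul_eq_mul]
      gcongr
      exact Finset.card_le_univ _
    have ha := (abs_le.1 (happrox (Finset.univ.filter fun l => N.first l = x.1))).1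
    have hb := (abs_le.1 (happrox (Finset.univ.filter fun l => N.last l = x.1))).2
    have hA : (∑ s ∈ Finset.range T, (A (j * T + s) ω x.1 x.2 : ℝ)) =
        ((∑ s ∈ Finset.range T, A (j * T + s) ω x.1 x.2 : ℕ) : ℝ) := by push_cast; rfl
    rw [hA]
    generalize (∑ l with N.first l = x.1, ∑ s ∈ Finset.range T, S (j * T + s) ω l x.2) = s
      at h1 hs ha
    generalize (∑ l with N.last l = x.1, ∑ s ∈ Finset.range T, S (j * T + s) ω l x.2) = a
      at h1 hi hb
    generalize (∑ s ∈ Finset.range T, A (j * T + s) ω x.1 x.2) = b at h1 ⊢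
    generalize (∑ l with N.first l = x.1, (p j ω l x.2 : ℝ) / q) = fo at ha ⊢
    generalize (∑ l with N.last l = x.1, (p j ω l x.2 : ℝ) / q) = fi at hb ⊢
    generalize Q ((j + 1) * T) ω x.1 x.2 = y at h1 ⊢
    generalize Q (j * T) ω x.1 x.2 = z at h1 ⊢
    have h2 : (y : ℝ) ≤ max ((z : ℝ) - s) 0 + (a + m * β + b) := by
      have h3 : ((z - s : ℕ) : ℝ) ≤ max ((z : ℝ) - s) 0 := by
        rcases le_total s z with h4 | h4
        · rw [Nat.cast_sub h4]; exact le_max_left _ _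
        · rw [Nat.sub_eq_zero_of_le h4]; simp
      have h4 : (y : ℝ) ≤ ((z - s : ℕ) : ℝ) + (a + m * β) + b := by exact_mod_cast h1
      linarith
    have h3 := sq_le_of_le_max_add (Nat.cast_nonneg y) (Nat.cast_nonneg z) (Nat.cast_nonneg s)
      (by positivity) h2
    have hs' : (s : ℝ) ≤ σ := by exact_mod_cast hs
    have hi' : (a : ℝ) ≤ σ := by exact_mod_cast hi
    have h4 : (s : ℝ) ^ 2 ≤ (σ : ℝ) ^ 2 := by gcongr
    have h5 : ((a : ℝ) + m * β + b) ^ 2 ≤ 2 * ((σ : ℝ) + m * β) ^ 2 + 2 * (b : ℝ) ^ 2 := by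
      have h6 : ((a : ℝ) + m * β + b) ^ 2 ≤ 2 * ((a : ℝ) + m * β) ^ 2 + 2 * (b : ℝ) ^ 2 := by
        nlinarith [sq_nonneg ((a : ℝ) + m * β - b)]
      have h7 : ((a : ℝ) + m * β) ^ 2 ≤ ((σ : ℝ) + m * β) ^ 2 := by gcongr
      linarith
    have h8 : (a : ℝ) + m * β + b - s ≤ T * (fi - fo) + T * (ε / 4) + b := by
      linarith
    have h9 := mul_le_mul_of_nonneg_left h8 (by positivity : (0 : ℝ) ≤ 2 * z)
    linarith
  have h1 := h.sum_flow_le hr.dest hG hslack hδ0 hδ j ω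
  refine (Finset.sum_le_sum key).trans ?_
  rw [Finset.sum_add_distrib, ← Finset.mul_sum]
  refine (add_le_add_right (mul_le_mul_of_nonneg_left h1 (by positivity)) _).trans ?_
  rw [Finset.mul_sum, ← Finset.sum_add_distrib]
  refine le_of_eq (Finset.sum_congr rfl fun x _ => ?_)
  ring

end Policy

end OverlayNetwork

/-! ### Moments, telescoping and strong stability -/

namespace OverlayNetwork

theorem stronglyStable_of_sum_integral_le {Ω : Type*} [MeasurableSpace Ω] {μ : Measure Ω}
    {Z : ℕ → Ω → ℕ} (hZ : ∀ t, Integrable (fun ω => (Z t ω : ℝ)) μ) {a b : ℝ} (ha : 0 ≤ a)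
    (hb : 0 ≤ b) (h : ∀ t : ℕ, ∑ s ∈ Finset.range t, ∫ ω, (Z s ω : ℝ) ∂μ ≤ a + b * t) :
    StronglyStable μ Z := by
  refine lt_of_le_of_lt (b := ENNReal.ofReal (a + b)) ?_ ENNReal.ofReal_lt_top
  refine limsup_le_of_le (by isBoundedDefault) ?_
  filter_upwards [eventually_ge_atTop 1] with t ht
  have ht' : (1 : ℝ) ≤ t := by exact_mod_cast ht
  rw [ENNReal.div_le_iff (by exact_mod_cast (by omega : t ≠ 0)) (by simp)]
  have h1 : ∀ s, ∫⁻ ω, (Z s ω : ℝ≥0∞) ∂μ = ENNReal.ofReal (∫ ω, (Z s ω : ℝ) ∂μ) := by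
    intro s
    rw [ofReal_integral_eq_lintegral_ofReal (hZ s) (Eventually.of_forall fun ω =>
      Nat.cast_nonneg _)]
    simp only [ENNReal.ofReal_natCast]
  simp only [h1]
  rw [← ENNReal.ofReal_sum_of_nonneg fun s _ => integral_nonneg fun ω => Nat.cast_nonneg _,
    ← ENNReal.ofReal_natCast t, ← ENNReal.ofReal_mul (by positivity)]
  refine ENNReal.ofReal_le_ofReal ((h t).trans ?_)
  nlinarith

theorem sum_range_mul_eq_sum_sum {M : Type*} [AddCommMonoid M] (f : ℕ → M) (J T : ℕ) :
    ∑ s ∈ Finset.range (J * T), f s =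
      ∑ j ∈ Finset.range J, ∑ i ∈ Finset.range T, f (j * T + i) := by
  induction J with
  | zero => simp
  | succ J ih =>
    rw [Finset.sum_range_succ, ← ih, add_mul, one_mul, Finset.sum_range_add]

variable {N : OverlayNetwork} {P : ForwardingScheme} {Ω : Type*} [mΩ : MeasurableSpace Ω]
  {μ : Measure Ω} {ℱ : Filtration ℕ mΩ} {A Q : ℕ → Ω → N.Overlay → N.Commodity → ℕ}
  {X : ℕ → Ω → N.Tunnel → N.Commodity → ℕ} {serve : ℕ → Ω → Finset N.Packet}
  {rate : N.Overlay → N.Commodity → ℝ}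

theorem IsArrivalSequence.memLp_sum (hA : N.IsArrivalSequence μ ℱ rate A) (t i : ℕ)
    (n : N.Overlay) (k : N.Commodity) :
    MemLp (fun ω => ∑ s ∈ Finset.range i, (A (t + s) ω n k : ℝ)) 2 μ :=
  memLp_finsetSum _ fun s _ => hA.memLp_apply (t + s) n k

theorem IsArrivalSequence.integral_sum [IsProbabilityMeasure μ]
    (hA : N.IsArrivalSequence μ ℱ rate A) (t i : ℕ) (n : N.Overlay) (k : N.Commodity) :
    ∫ ω, ∑ s ∈ Finset.range i, (A (t + s) ω n k : ℝ) ∂μ = i * rate n k := by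
  rw [integral_finsetSum _ fun s _ => (hA.memLp_apply (t + s) n k).integrable (by norm_num)]
  simp [hA.integral_apply]

theorem IsArrivalSequence.integral_sum_sq_le (hA : N.IsArrivalSequence μ ℱ rate A) (t i : ℕ)
    (n : N.Overlay) (k : N.Commodity) :
    ∫ ω, (∑ s ∈ Finset.range i, (A (t + s) ω n k : ℝ)) ^ 2 ∂μ ≤
      i * (i * ∫ ω, (A 0 ω n k : ℝ) ^ 2 ∂μ) := by
  have hsq : ∀ s, Integrable (fun ω => (A s ω n k : ℝ) ^ 2) μ := fun s =>
    (hA.memLp_apply s n k).integrable_sq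
  calc _ ≤ ∫ ω, (i : ℝ) * ∑ s ∈ Finset.range i, (A (t + s) ω n k : ℝ) ^ 2 ∂μ := by
        refine integral_mono (hA.memLp_sum t i n k).integrable_sq
          ((integrable_finsetSum _ fun s _ => hsq _).const_mul _) fun ω => ?_
        have := sq_sum_le_card_mul_sum_sq (s := Finset.range i)
          (f := fun s => (A (t + s) ω n k : ℝ))
        simpa using this
    _ = _ := by
        rw [integral_const_mul, integral_finsetSum _ fun s _ => hsq _]
        have h1 : ∀ s, ∫ ω, (A s ω n k : ℝ) ^ 2 ∂μ = ∫ ω, (A 0 ω n k : ℝ) ^ 2 ∂μ := fun s =>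
          ((hA.identDistrib_apply s n k).comp (u := fun x : ℝ => x ^ 2)
            (by fun_prop)).integral_eq
        simp [h1]

/-- Each later arrival is independent of its own past, which contains `ℱ t`; by linearity no joint
independence is needed. -/
theorem IsArrivalSequence.integral_mul_sum [IsProbabilityMeasure μ]
    (hA : N.IsArrivalSequence μ ℱ rate A) {t : ℕ} {Z : Ω → ℕ} (hZ : Measurable[ℱ t] Z)
    (hZ2 : MemLp (fun ω => (Z ω : ℝ)) 2 μ) (i : ℕ) (n : N.Overlay) (k : N.Commodity) :
    ∫ ω, (Z ω : ℝ) * ∑ s ∈ Finset.range i, (A (t + s) ω n k : ℝ) ∂μ =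
      i * rate n k * ∫ ω, (Z ω : ℝ) ∂μ := by
  simp only [Finset.mul_sum]
  have hi : ∀ s, Integrable (fun ω => (Z ω : ℝ) * (A s ω n k : ℝ)) μ := fun s =>
    hZ2.integrable_mul (hA.memLp_apply s n k)
  rw [integral_finsetSum _ fun s _ => hi (t + s)]
  have hc : Measurable (fun m : ℕ => (m : ℝ)) := Measurable.of_discrete
  have h1 : ∀ s, ∫ ω, (Z ω : ℝ) * (A (t + s) ω n k : ℝ) ∂μ =
      (∫ ω, (Z ω : ℝ) ∂μ) * rate n k := by
    intro s
    have hind : IndepFun (A (t + s)) Z μ := by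
      rw [IndepFun_iff_Indep]
      exact indep_of_indep_of_le_right (hA.indep (t + s))
        (hZ.comap_le.trans (ℱ.mono (by omega)))
    have hind' : IndepFun (fun ω => (Z ω : ℝ)) (fun ω => (A (t + s) ω n k : ℝ)) μ :=
      (hind.comp (φ := fun a : N.Overlay → N.Commodity → ℕ => (a n k : ℝ))
        (ψ := fun m : ℕ => (m : ℝ))
        (hc.comp ((measurable_pi_apply k).comp (measurable_pi_apply n))) hc).symm
    have := hind'.integral_mul_eq_mul_integral hZ2.aestronglyMeasurable
      (hA.memLp_apply (t + s) n k).aestronglyMeasurable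
    rw [← hA.integral_apply (t + s) n k]
    exact this
  simp only [h1, Finset.sum_const, Finset.card_range, nsmul_eq_mul]
  ring

/-- Nonnegative arrivals of nonpositive mean vanish almost surely and no tunnel touches the pair, so
the backlog almost surely keeps its initial value. -/
theorem IsRun.stronglyStable_of_not_carries [IsProbabilityMeasure μ]
    (hr : N.IsRun P μ ℱ A Q X serve) (hA : N.IsArrivalSequence μ ℱ rate A) {n : N.Overlay}
    {k : N.Commodity} (hn : n ≠ N.dest k) (hc : ¬ N.Carries n k) (hrate : rate n k ≤ 0) :
    StronglyStable μ (fun t ω => Q t ω n k) := by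
  have hA0 : ∀ t, ∀ᵐ ω ∂μ, A t ω n k = 0 := by
    intro t
    have hi : Integrable (fun ω => (A t ω n k : ℝ)) μ :=
      (hA.memLp_apply t n k).integrable (by norm_num)
    have h0 : ∫ ω, (A t ω n k : ℝ) ∂μ = 0 :=
      le_antisymm ((hA.integral_apply t n k).trans_le hrate)
        (integral_nonneg fun ω => Nat.cast_nonneg _)
    have := (integral_eq_zero_iff_of_nonneg (fun ω => Nat.cast_nonneg _) hi).1 h0
    filter_upwards [this] with ω hω
    have hω' : (A t ω n k : ℝ) = 0 := hω
    exact_mod_cast hω'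
  have hQ : ∀ t, ∀ᵐ ω ∂μ, (Q t ω n k : ℝ) = (Q 0 ω n k : ℝ) := by
    intro t
    induction t with
    | zero => exact Eventually.of_forall fun ω => rfl
    | succ t ih =>
      filter_upwards [ih, hA0 t] with ω h1 h2
      rw [← h1]
      have h3 := hr.step t ω n k hn
      rw [Finset.sum_eq_zero (s := Finset.univ.filter fun l => N.first l = n),
        Finset.sum_eq_zero (s := Finset.univ.filter fun l => N.last l = n), h2] at h3
      · have : Q (t + 1) ω n k = Q t ω n k := by omega
        rw [this]
      · exact fun l hl => (hr.workConserving ω).exits_eq_zero (fun s => hr.usable s ω l k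
          fun hu => hc ⟨l, hu, Or.inr (Finset.mem_filter.1 hl).2⟩) t
      · exact fun l hl => hr.usable t ω l k
          fun hu => hc ⟨l, hu, Or.inl (Finset.mem_filter.1 hl).2⟩
  have h0 : Integrable (fun ω => (Q 0 ω n k : ℝ)) μ := (hr.memLp_init n k).integrable (by norm_num)
  refine stronglyStable_of_sum_integral_le (a := 0) (b := ∫ ω, (Q 0 ω n k : ℝ) ∂μ)
    (fun t => h0.congr (by filter_upwards [hQ t] with ω h using h.symm)) le_rfl
    (integral_nonneg fun ω => Nat.cast_nonneg _) fun t => ?_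
  rw [Finset.sum_congr rfl fun s _ => integral_congr_ae (hQ s)]
  simp [mul_comm]

section Policy

variable {T q : ℕ} {δ : ℝ} {S p : ℕ → Ω → N.Tunnel → N.Commodity → ℕ}

theorem IsCentralizedPolicy.backlog_frame_le (h : N.IsCentralizedPolicy T q δ ℱ Q X S p)
    (hr : N.IsRun P μ ℱ A Q X serve) (hq : 0 < q) {β : ℕ}
    (hβ : ∀ t ω, underlayBacklog (fun s => X s ω) (fun s => serve s ω) t ≤ β) :
    ∃ D : ℕ, ∀ j i, i ≤ T → ∀ ω n k, (Q (j * T + i) ω n k : ℝ) ≤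
      Q (j * T) ω n k + D + ∑ s ∈ Finset.range i, (A (j * T + s) ω n k : ℝ) := by
  obtain ⟨C, -, hC⟩ := N.exists_cap_le
  refine ⟨Fintype.card N.Tunnel * ((T + q) * C) + Fintype.card N.Tunnel * β,
    fun j i hi ω n k => ?_⟩
  by_cases hn : n = N.dest k
  · subst hn
    rw [hr.dest, hr.dest, Nat.cast_zero]
    positivity
  · have h1 := h.backlog_add_le hr hβ hn (j * T) i ω
    have h2 := h.sum_schedule_le hq hC j ω hi (Finset.univ.filter fun l => N.last l = n) k
    have h3 : Q (j * T + i) ω n k ≤ Q (j * T) ω n k + (Fintype.card N.Tunnel * ((T + q) * C)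
        + Fintype.card N.Tunnel * β) + ∑ s ∈ Finset.range i, A (j * T + s) ω n k := by
      omega
    exact_mod_cast h3

/-- Within a frame the backlog grows by at most a constant plus the arrivals, so second moments pass
from frame to frame. -/
theorem IsCentralizedPolicy.memLp_backlog_frame [IsProbabilityMeasure μ]
    (h : N.IsCentralizedPolicy T q δ ℱ Q X S p) (hr : N.IsRun P μ ℱ A Q X serve)
    (hA : N.IsArrivalSequence μ ℱ rate A) (hq : 0 < q) {β : ℕ}
    (hβ : ∀ t ω, underlayBacklog (fun s => X s ω) (fun s => serve s ω) t ≤ β)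
    (j i : ℕ) (hi : i ≤ T) (n : N.Overlay) (k : N.Commodity) :
    MemLp (fun ω => (Q (j * T + i) ω n k : ℝ)) 2 μ := by
  obtain ⟨D, hD⟩ := h.backlog_frame_le hr hq hβ
  have hc : Measurable (fun m : ℕ => (m : ℝ)) := Measurable.of_discrete
  have hstep : ∀ j i, i ≤ T → MemLp (fun ω => (Q (j * T) ω n k : ℝ)) 2 μ →
      MemLp (fun ω => (Q (j * T + i) ω n k : ℝ)) 2 μ := by
    intro j i hi hj
    refine MemLp.of_le ((hj.add (memLp_const (D : ℝ))).add (hA.memLp_sum (j * T) i n k))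
      (hc.comp ((hr.measurable_backlog hA _ n k).mono (ℱ.le _) le_rfl)).aestronglyMeasurable
      (Eventually.of_forall fun ω => ?_)
    rw [Real.norm_natCast]
    exact (hD j i hi ω n k).trans (le_abs_self _)
  refine hstep j i hi ?_
  induction j with
  | zero => simpa using hr.memLp_init n k
  | succ j ih =>
    rw [add_mul, one_mul]
    exact hstep j T le_rfl ih

/-- The expected drift inequality is telescoped over the frames, and the final Lyapunov value is
dropped as nonnegative. -/
theorem IsCentralizedPolicy.sum_integral_backlog_le [IsProbabilityMeasure μ]
    (h : N.IsCentralizedPolicy T q δ ℱ Q X S p) (hr : N.IsRun P μ ℱ A Q X serve)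
    (hA : N.IsArrivalSequence μ ℱ rate A) (hq : 0 < q) {β : ℕ}
    (hβ : ∀ t ω, underlayBacklog (fun s => X s ω) (fun s => serve s ω) t ≤ β)
    {C : ℕ} (hC : ∀ a b, N.cap a b ≤ C) {ε : ℝ} {G : N.Tunnel → N.Commodity → ℝ}
    (hG : N.IsFeasible G)
    (hslack : ∀ n k, n ≠ N.dest k → N.Carries n k →
      rate n k + ε + ∑ l with N.last l = n, G l k ≤ ∑ l with N.first l = n, G l k)
    (hδ0 : 0 ≤ δ) (hδ : 2 * Fintype.card N.Tunnel * δ ≤ ε / 2)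
    (hT : (2 * Fintype.card N.Tunnel * (q * C) + Fintype.card N.Tunnel * β : ℝ) ≤ T * (ε / 4)) :
    ∃ a b : ℝ, ∀ J : ℕ, T * (ε / 2) * ∑ j ∈ Finset.range J, ∑ x ∈ N.active,
      ∫ ω, (Q (j * T) ω x.1 x.2 : ℝ) ∂μ ≤ a + b * J := by
  obtain ⟨D, hD⟩ := h.sum_sq_backlog_le hr hq hβ hC hG hslack hδ0 hδ hT
  have hQ2 : ∀ j n k, MemLp (fun ω => (Q (j * T) ω n k : ℝ)) 2 μ := fun j n k =>
    h.memLp_backlog_frame hr hA hq hβ j 0 (Nat.zero_le _) n k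
  set V : ℕ → ℝ := fun j => ∑ x ∈ N.active, ∫ ω, (Q (j * T) ω x.1 x.2 : ℝ) ^ 2 ∂μ with hV
  set U : ℕ → ℝ := fun j => ∑ x ∈ N.active, ∫ ω, (Q (j * T) ω x.1 x.2 : ℝ) ∂μ with hU
  set b : ℝ := ∑ x ∈ N.active,
    (D + 2 * (T * (T * ∫ ω, (A 0 ω x.1 x.2 : ℝ) ^ 2 ∂μ))) with hb
  have hdrift : ∀ j, V (j + 1) ≤ V j + b - T * (ε / 2) * U j := by
    intro j
    have hi1 : ∀ n k, Integrable (fun ω => (Q (j * T) ω n k : ℝ) ^ 2) μ := fun n k =>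
      (hQ2 j n k).integrable_sq
    have hi2 : ∀ n k, Integrable
        (fun ω => (∑ s ∈ Finset.range T, (A (j * T + s) ω n k : ℝ)) ^ 2) μ := fun n k =>
      (hA.memLp_sum (j * T) T n k).integrable_sq
    have hi3 : ∀ n k, Integrable (fun ω => (Q (j * T) ω n k : ℝ) *
        ((∑ s ∈ Finset.range T, (A (j * T + s) ω n k : ℝ)) - T * rate n k)) μ := fun n k =>
      (hQ2 j n k).integrable_mul ((hA.memLp_sum (j * T) T n k).sub (memLp_const _))
    have hi4 : ∀ n k, Integrable (fun ω => (Q (j * T) ω n k : ℝ)) μ := fun n k =>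
      (hQ2 j n k).integrable (by norm_num)
    have hi12 : ∀ n k, Integrable (fun ω => (Q (j * T) ω n k : ℝ) ^ 2 + D
        + 2 * (∑ s ∈ Finset.range T, (A (j * T + s) ω n k : ℝ)) ^ 2) μ := fun n k =>
      ((hi1 n k).add (integrable_const D)).add ((hi2 n k).const_mul 2)
    have hi1D : ∀ n k, Integrable (fun ω => (Q (j * T) ω n k : ℝ) ^ 2 + D) μ := fun n k =>
      (hi1 n k).add (integrable_const D)
    have hi123 : ∀ n k, Integrable (fun ω => (Q (j * T) ω n k : ℝ) ^ 2 + D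
        + 2 * (∑ s ∈ Finset.range T, (A (j * T + s) ω n k : ℝ)) ^ 2
        + 2 * ((Q (j * T) ω n k : ℝ) *
          ((∑ s ∈ Finset.range T, (A (j * T + s) ω n k : ℝ)) - T * rate n k))) μ := fun n k =>
      (hi12 n k).add ((hi3 n k).const_mul 2)
    have hi : ∀ n k, Integrable (fun ω => (Q (j * T) ω n k : ℝ) ^ 2 + D
        + 2 * (∑ s ∈ Finset.range T, (A (j * T + s) ω n k : ℝ)) ^ 2
        + 2 * ((Q (j * T) ω n k : ℝ) *
          ((∑ s ∈ Finset.range T, (A (j * T + s) ω n k : ℝ)) - T * rate n k))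
        - T * (ε / 2) * Q (j * T) ω n k) μ := fun n k =>
      (hi123 n k).sub ((hi4 n k).const_mul _)
    -- The backlog at the frame start is uncorrelated with the centered arrivals of the frame.
    have h0 : ∀ n k, ∫ ω, (Q (j * T) ω n k : ℝ) *
        ((∑ s ∈ Finset.range T, (A (j * T + s) ω n k : ℝ)) - T * rate n k) ∂μ = 0 := by
      intro n k
      have hi5 : Integrable (fun ω => (Q (j * T) ω n k : ℝ) *
          ∑ s ∈ Finset.range T, (A (j * T + s) ω n k : ℝ)) μ :=
        (hQ2 j n k).integrable_mul (hA.memLp_sum (j * T) T n k)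
      simp only [mul_sub]
      rw [integral_sub hi5 ((hi4 n k).mul_const _),
        hA.integral_mul_sum (hr.measurable_backlog hA (j * T) n k) (hQ2 j n k),
        integral_mul_const]
      ring
    calc V (j + 1) = ∫ ω, ∑ x ∈ N.active, (Q ((j + 1) * T) ω x.1 x.2 : ℝ) ^ 2 ∂μ := by
          rw [integral_finsetSum _ fun x _ => (hQ2 (j + 1) x.1 x.2).integrable_sq]
      _ ≤ _ := integral_mono
          (integrable_finsetSum _ fun x _ => (hQ2 (j + 1) x.1 x.2).integrable_sq)
          (integrable_finsetSum _ fun x _ => hi x.1 x.2) (hD j)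
      _ ≤ V j + b - T * (ε / 2) * U j := by
          rw [integral_finsetSum _ fun x _ => hi x.1 x.2]
          simp only [hV, hb, hU]
          rw [Finset.mul_sum, ← Finset.sum_add_distrib, ← Finset.sum_sub_distrib]
          refine Finset.sum_le_sum fun x _ => ?_
          rw [integral_sub (hi123 x.1 x.2) ((hi4 x.1 x.2).const_mul _),
            integral_add (hi12 x.1 x.2) ((hi3 x.1 x.2).const_mul 2),
            integral_add (hi1D x.1 x.2) ((hi2 x.1 x.2).const_mul 2),
            integral_add (hi1 x.1 x.2) (integrable_const D), integral_const_mul,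
            integral_const_mul, integral_const_mul, h0, integral_const]
          have := hA.integral_sum_sq_le (j * T) T x.1 x.2
          simp only [probReal_univ, one_smul]
          linarith
  have hV0 : ∀ j, 0 ≤ V j := fun j =>
    Finset.sum_nonneg fun x _ => integral_nonneg fun ω => sq_nonneg _
  refine ⟨V 0, b, fun J => ?_⟩
  have htel : V J + T * (ε / 2) * ∑ j ∈ Finset.range J, U j ≤ V 0 + b * J := by
    induction J with
    | zero => simp
    | succ J ih =>
      have := hdrift J
      rw [Finset.sum_range_succ]
      push_cast
      linarith
  have := hV0 J
  linarith

theorem IsCentralizedPolicy.stronglyStable_of_mem_active [IsProbabilityMeasure μ]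
    (h : N.IsCentralizedPolicy T q δ ℱ Q X S p) (hr : N.IsRun P μ ℱ A Q X serve)
    (hA : N.IsArrivalSequence μ ℱ rate A) (hq : 0 < q) (hT0 : 0 < T) {β : ℕ}
    (hβ : ∀ t ω, underlayBacklog (fun s => X s ω) (fun s => serve s ω) t ≤ β)
    {c : ℝ} (hc : 0 < c) {a b : ℝ}
    (hsum : ∀ J : ℕ, c * ∑ j ∈ Finset.range J, ∑ x ∈ N.active,
      ∫ ω, (Q (j * T) ω x.1 x.2 : ℝ) ∂μ ≤ a + b * J)
    {x : N.Overlay × N.Commodity} (hx : x ∈ N.active) :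
    StronglyStable μ (fun t ω => Q t ω x.1 x.2) := by
  obtain ⟨D, hD⟩ := h.backlog_frame_le hr hq hβ
  have hint : ∀ j i, i ≤ T → Integrable (fun ω => (Q (j * T + i) ω x.1 x.2 : ℝ)) μ :=
    fun j i hi => (h.memLp_backlog_frame hr hA hq hβ j i hi x.1 x.2).integrable (by norm_num)
  have hint' : ∀ t, Integrable (fun ω => (Q t ω x.1 x.2 : ℝ)) μ := fun t => by
    rw [← Nat.div_add_mod' t T]
    exact hint _ _ (Nat.mod_lt t hT0).le
  have hrate0 : 0 ≤ rate x.1 x.2 := by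
    rw [← hA.integral_apply 0]
    exact integral_nonneg fun ω => Nat.cast_nonneg _
  -- The largest expected growth of the backlog within one frame, which transfers the bound from
  -- frame starts to all slots.
  set d : ℝ := D + T * rate x.1 x.2 with hd
  have hd0 : 0 ≤ d := by positivity
  have hstep : ∀ j i, i ≤ T → ∫ ω, (Q (j * T + i) ω x.1 x.2 : ℝ) ∂μ ≤
      ∫ ω, (Q (j * T) ω x.1 x.2 : ℝ) ∂μ + d := by
    intro j i hi
    have hAi : Integrable (fun ω => ∑ s ∈ Finset.range i, (A (j * T + s) ω x.1 x.2 : ℝ)) μ :=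
      (hA.memLp_sum (j * T) i x.1 x.2).integrable (by norm_num)
    have hQD : Integrable (fun ω => (Q (j * T) ω x.1 x.2 : ℝ) + D) μ :=
      (hint' (j * T)).add (integrable_const _)
    have h1 := integral_mono (hint j i hi) (hQD.add hAi) fun ω => hD j i hi ω x.1 x.2
    rw [integral_add' hQD hAi, integral_add (hint' (j * T)) (integrable_const _),
      hA.integral_sum, integral_const] at h1
    simp only [probReal_univ, one_smul] at h1
    have h2 : (i : ℝ) * rate x.1 x.2 ≤ T * rate x.1 x.2 := by gcongr
    linarith
  have hframes : ∀ J : ℕ, ∑ j ∈ Finset.range J, ∫ ω, (Q (j * T) ω x.1 x.2 : ℝ) ∂μ ≤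
      (|a| + |b| * J) / c := by
    intro J
    rw [le_div_iff₀ hc, mul_comm]
    have h1 : ∑ j ∈ Finset.range J, ∫ ω, (Q (j * T) ω x.1 x.2 : ℝ) ∂μ ≤
        ∑ j ∈ Finset.range J, ∑ x ∈ N.active, ∫ ω, (Q (j * T) ω x.1 x.2 : ℝ) ∂μ :=
      Finset.sum_le_sum fun j _ => Finset.single_le_sum
        (f := fun x : N.Overlay × N.Commodity => ∫ ω, (Q (j * T) ω x.1 x.2 : ℝ) ∂μ)
        (fun x _ => integral_nonneg fun ω => Nat.cast_nonneg _) hx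
    have h2 := (mul_le_mul_of_nonneg_left h1 hc.le).trans (hsum J)
    have h3 : b * J ≤ |b| * J := by gcongr; exact le_abs_self b
    linarith [le_abs_self a]
  refine stronglyStable_of_sum_integral_le hint' (a := T * ((|a| + |b|) / c + d))
    (b := T * (|b| / c + d)) (by positivity) (by positivity) fun t => ?_
  set J := t / T + 1 with hJ
  have hJt : J ≤ t + 1 := by
    have := Nat.div_le_self t T
    omega
  have htJ : t ≤ J * T := by
    have := Nat.lt_div_mul_add hT0 (a := t)
    rw [hJ, add_mul, one_mul]
    exact this.le
  have hJt' : (J : ℝ) ≤ t + 1 := by exact_mod_cast hJt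
  calc ∑ s ∈ Finset.range t, ∫ ω, (Q s ω x.1 x.2 : ℝ) ∂μ
      ≤ ∑ s ∈ Finset.range (J * T), ∫ ω, (Q s ω x.1 x.2 : ℝ) ∂μ :=
        Finset.sum_le_sum_of_subset_of_nonneg (Finset.range_mono htJ)
          fun s _ _ => integral_nonneg fun ω => Nat.cast_nonneg _
    _ = ∑ j ∈ Finset.range J, ∑ i ∈ Finset.range T,
          ∫ ω, (Q (j * T + i) ω x.1 x.2 : ℝ) ∂μ := sum_range_mul_eq_sum_sum _ _ _
    _ ≤ ∑ j ∈ Finset.range J, ∑ i ∈ Finset.range T,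
          (∫ ω, (Q (j * T) ω x.1 x.2 : ℝ) ∂μ + d) :=
        Finset.sum_le_sum fun j _ => Finset.sum_le_sum fun i hi =>
          hstep j i (Finset.mem_range.1 hi).le
    _ = T * (∑ j ∈ Finset.range J, ∫ ω, (Q (j * T) ω x.1 x.2 : ℝ) ∂μ + d * J) := by
        simp only [Finset.sum_const, Finset.card_range, nsmul_eq_mul, ← Finset.mul_sum,
          Finset.sum_add_distrib]
        ring
    _ ≤ T * ((|a| + |b| * (t + 1)) / c + d * (t + 1)) := by
        refine mul_le_mul_of_nonneg_left (add_le_add ((hframes J).trans ?_) ?_)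
          (Nat.cast_nonneg _)
        · gcongr
        · gcongr
    _ = _ := by ring

end Policy

end OverlayNetwork

/-! ### Choice of the constants -/

theorem theorem1 (N : OverlayNetwork) (P : ForwardingScheme)
    (hP : OverlayNetwork.UniversallyStable P)
    (rate : N.Overlay → N.Commodity → ℝ) (hrate : N.InsideRegion P rate) :
    ∃ δ : ℝ, 0 < δ ∧ ∀ q : ℕ, 0 < q → ∃ B T₀ : ℕ, ∀ T : ℕ, T₀ ≤ T →
      ∀ {Ω : Type*} [mΩ : MeasurableSpace Ω] (μ : Measure Ω) [IsProbabilityMeasure μ]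
        (ℱ : Filtration ℕ mΩ) (A Q : ℕ → Ω → N.Overlay → N.Commodity → ℕ)
        (X S p : ℕ → Ω → N.Tunnel → N.Commodity → ℕ) (serve : ℕ → Ω → Finset N.Packet),
        N.IsArrivalSequence μ ℱ rate A →
        N.IsRun P μ ℱ A Q X serve →
        N.IsCentralizedPolicy T q δ ℱ Q X S p →
          (∀ n k, OverlayNetwork.StronglyStable μ (fun t ω => Q t ω n k)) ∧
          ∀ ω t e, (OverlayNetwork.queue (fun s => X s ω) (fun s => serve s ω) t e).card ≤ B := by
  obtain ⟨ε, hε, ⟨G, hG, hslack⟩, hidle⟩ := hrate.exists_feasible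
  obtain ⟨C, hC0, hC⟩ := N.exists_cap_le
  set m : ℕ := Fintype.card N.Tunnel with hm
  -- The `+ 1` keeps `δ` well defined and positive when there are no tunnels.
  refine ⟨ε / (4 * (m + 1)), by positivity, fun q hq => ?_⟩
  have hδ : 2 * m * (ε / (4 * (m + 1))) ≤ ε / 2 := by
    rw [mul_div_assoc', div_le_iff₀ (by positivity)]
    nlinarith
  have hw : 0 < 8 * q ^ 2 * C := by positivity
  have hr1 : (1 - 1 / (2 * q * C) : ℝ) < 1 := by
    have : (0 : ℝ) < 1 / (2 * q * C) := by positivity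
    linarith
  -- The bound `B` is fixed before `T`; this avoids circularity, since the threshold for `T` depends
  -- on `B` through `β`.
  obtain ⟨B, hB⟩ := hP N (8 * q ^ 2 * C) (1 - 1 / (2 * q * C)) hw hr1
  set β : ℕ := Fintype.card (N.Node × N.Node) * B with hβdef
  set K : ℝ := 2 * m * (q * C) + m * β with hK
  -- The first term makes a frame at least as long as the adversary window; the second makes the
  -- per-frame error `K` small compared with the slack collected over a frame.
  refine ⟨B, max (8 * q ^ 2 * C) ⌈K / (ε / 4)⌉₊, fun T hT Ω mΩ μ _ ℱ A Q X S p serve hA hr h => ?_⟩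
  have hT1 : 8 * q ^ 2 * C ≤ T := (le_max_left _ _).trans hT
  have hT2 : K ≤ T * (ε / 4) := by
    rw [← div_le_iff₀ (by positivity)]
    exact (Nat.le_ceil _).trans (by exact_mod_cast (le_max_right _ _).trans hT)
  have hqueue : ∀ ω t e,
      (OverlayNetwork.queue (fun s => X s ω) (fun s => serve s ω) t e).card ≤ B := fun ω =>
    hB _ _ (hr.executes ω) (h.boundedAdversary hq hC0 hC hT1 ω)
  have hβ : ∀ t ω, OverlayNetwork.underlayBacklog (fun s => X s ω) (fun s => serve s ω) t ≤ β :=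
    fun t ω => (Finset.sum_le_card_nsmul _ _ B fun e _ => hqueue ω t e).trans_eq (by
      rw [smul_eq_mul, Finset.card_univ])
  refine ⟨fun n k => ?_, hqueue⟩
  by_cases hn : n = N.dest k
  · subst hn
    simp [OverlayNetwork.StronglyStable, hr.dest]
  by_cases hc : N.Carries n k
  · have hT0 : 0 < T := hw.trans_le hT1
    obtain ⟨a, b, hab⟩ := h.sum_integral_backlog_le hr hA hq hβ hC hG hslack (by positivity) hδ hT2
    have hc0 : 0 < T * (ε / 2) := by positivity
    have hmem : (n, k) ∈ N.active := OverlayNetwork.mem_active.2 ⟨hn, hc⟩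
    have hstable := h.stronglyStable_of_mem_active hr hA hq hT0 hβ hc0 hab hmem
    exact hstable
  · exact hr.stronglyStable_of_not_carries hA hn hc (hidle n k hn hc)
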